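/- Let $m,n\ge 1$, let $x_0<x_1<\dots<x_m$ and $y_0<y_1<\dots<y_n$ be real numbers, and let $\Omega=[x_0,x_m]\times[y_0,y_n]$. Put $x_{-1}=x_0$, $x_{m+1}=x_m$, $y_{-1}=y_0$, $y_{n+1}=y_n$, and for $0\le i\le m+1$, $0\le j\le n+1$ let $$h_i=x_i-x_{i-1},\quad k_j=y_j-y_{j-1},\quad s_i=\tfrac12(x_{i-1}+x_i),\quad t_j=\tfrac12(y_{j-1}+y_j)$$ (with $h_0=h_{m+1}=k_0=k_{n+1}=0$, $s_0=x_0$, $s_{m+1}=x_m$, $t_0=y_0$, $t_{n+1}=y_n$). Let $h$ be the maximum and $\delta$ the minimum of the numbers $h_1,\dots,h_m,k_1,\dots,k_n$. **B-splines.** The criss-cross triangulation of $\Omega$ is obtained by drawing both diagonals in each rectangle $[x_{i-1},x_i]\times[y_{j-1},y_j]$. Let $N_0,\dots,N_{m+1}$ be the univariate quadratic B-splines (normalized to a partition of unity) on $[x_0,x_m]$ with simple knots $x_1,\dots,x_{m-1}$ and triple knots $x_0,x_m$, and let $\tilde N_0,\dots,\tilde N_{n+1}$ be those for $y_0,\dots,y_n$.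 The B-spline $B_{ij}$, $0\le i\le m+1$, $0\le j\le n+1$, is the unique $C^1$ function on $\Omega$ that is a polynomial of total degree at most $2$ on each triangle of the triangulation and that has, at every vertex $(x_k,y_l)$, $0\le k\le m$, $0\le l\le n$, the same value and the same gradient as $N_i(x)\tilde N_j(y)$. (These are the usual $C^1$ quadratic B-splines with octagonal support if $2\le i\le m-1$ and $2\le j\le n-1$, and their analogues with support in $\Omega$ near the boundary.) **Quasi-interpolants.** For $1\le i\le m+1$ let $\sigma_i=\frac{h_i}{h_{i-1}+h_i}$, $\sigma_i'=1-\sigma_i$; for $1\le i\le m$ let $$a_i=-\frac{\sigma_i^2\sigma_{i+1}'}{\sigma_i+\sigma_{i+1}'},\qquad c_i=-\frac{\sigma_i(\sigma_{i+1}')^2}{\sigma_i+\sigma_{i+1}'},$$ and let $a_0=c_0=a_{m+1}=c_{m+1}=0$. Let $\bar a_j,\bar c_j$, $0\le j\le n+1$, be defined in the same way from $k_0,\dots,k_{n+1}$, and let $b_{ij}=1-(a_i+c_i+\bar a_j+\bar c_j)$. With $$\mu_{ij}(f)=b_{ij}f(s_i,t_j)+a_if(s_{i-1},t_j)+c_if(s_{i+1},t_j)+\bar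 a_jf(s_i,t_{j-1})+\bar c_jf(s_i,t_{j+1})$$ (terms with a zero coefficient and an index out of range are omitted) and $$\mu^*_{ij}(f)=2f(s_i,t_j)-\tfrac14\bigl[f(x_{i-1},y_{j-1})+f(x_{i-1},y_j)+f(x_i,y_{j-1})+f(x_i,y_j)\bigr],$$ put $$S_2f=\sum_{i=0}^{m+1}\sum_{j=0}^{n+1}\mu_{ij}(f)B_{ij},\qquad W_2^*f=\sum_{i=0}^{m+1}\sum_{j=0}^{n+1}\mu^*_{ij}(f)B_{ij}.$$ **Norms and moduli.** $\|\cdot\|$ is the supremum norm over $\Omega$, $D^\alpha=\partial^{\alpha_1+\alpha_2}/\partial x^{\alpha_1}\partial y^{\alpha_2}$, and $|\alpha|=\alpha_1+\alpha_2$; $\|D^3f\|=\max_{|\alpha|=3}\|D^\alpha f\|$; and $\omega(D^2f,t)=\max_{|\alpha|=2}\omega(D^\alpha f,t)$, where $\omega(\psi,t)=\max\{|\psi(M)-\psi(P)|: M,P\in\Omega,\ |M-P|\le t\}$ with the Euclidean distance $|M-P|$. **Theorem.** Let $Q$ be one of the operators $S_2$, $W_2^*$. The function $Qf$ is of class $C^1$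 on $\Omega$, and the following estimates hold. (i) There is a constant $\bar C_2>0$, with $\bar C_2\le122$ for $Q=S_2$ and $\bar C_2\le65$ for $Q=W_2^*$, such that, for all partitions as above, all $f\in C^2(\Omega)$ and $|\alpha|=1$, $$\|D^\alpha f-D^\alpha Qf\|\le\Bigl[1+\bar C_2\Bigl(\frac h\delta\Bigr)\Bigr]\,h\,\omega\Bigl(D^2f,\frac h2\Bigr).$$ (ii) There is a constant $\bar C_3>0$, with $\bar C_3\le\frac{269}{12}$ for $Q=S_2$ and $\bar C_3\le\frac{65}{6}$ for $Q=W_2^*$, such that, for all partitions as above, all $f\in C^3(\Omega)$ and $|\alpha|=1$, $$\|D^\alpha f-D^\alpha Qf\|\le\bar C_3\Bigl(\frac h\delta\Bigr)h^2\,\|D^3f\|.$$ -/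

import Mathlib

noncomputable section

namespace CrissCross

/-- A partition `x 0 < x 1 < ⋯ < x m` of the segment `[x 0, x m]` into `m ≥ 1` subintervals.
Only the values `x 0, …, x m` are ever used. -/
structure Knots where
  m : ℕ
  one_le : 1 ≤ m
  x : ℕ → ℝ
  lt_succ : ∀ i < m, x i < x (i + 1)

namespace Knots

variable (X : Knots)

/-- The segment `[x 0, x m]`. -/
def segment : Set ℝ := Set.Icc (X.x 0) (X.x X.m)

/-- The knots with the convention `x i = x m` for `i ≥ m`. Natural-number subtraction gives the
other convention: `X.knot (i - 1)` is `x 0` for `i = 0`, that is, `x (-1) = x 0`. -/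
def knot (i : ℕ) : ℝ := X.x (min i X.m)

/-- Step lengths `h i = x i - x (i - 1)`; one has `h 0 = h (m + 1) = 0`. -/
def step (i : ℕ) : ℝ := X.knot i - X.knot (i - 1)

/-- Midpoints `s i = (x (i - 1) + x i) / 2`; one has `s 0 = x 0` and `s (m + 1) = x m`. -/
def mid (i : ℕ) : ℝ := (X.knot (i - 1) + X.knot i) / 2

/-- `σ i = h i / (h (i - 1) + h i)`, used for `1 ≤ i ≤ m + 1`. -/
def sigma (i : ℕ) : ℝ := X.step i / (X.step (i - 1) + X.step i)

/-- `σ' i = h (i - 1) / (h (i - 1) + h i)`, used for `1 ≤ i ≤ m + 1`. -/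
def sigma' (i : ℕ) : ℝ := X.step (i - 1) / (X.step (i - 1) + X.step i)

/-- `a i = - (σ i)² σ' (i + 1) / (σ i + σ' (i + 1))` for `1 ≤ i ≤ m`, and `a 0 = a (m + 1) = 0`. -/
def coefA (i : ℕ) : ℝ :=
  if 1 ≤ i ∧ i ≤ X.m then
    -(X.sigma i ^ 2 * X.sigma' (i + 1) / (X.sigma i + X.sigma' (i + 1)))
  else 0

/-- `c i = - σ i (σ' (i + 1))² / (σ i + σ' (i + 1))` for `1 ≤ i ≤ m`, and `c 0 = c (m + 1) = 0`. -/
def coefC (i : ℕ) : ℝ :=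
  if 1 ≤ i ∧ i ≤ X.m then
    -(X.sigma i * X.sigma' (i + 1) ^ 2 / (X.sigma i + X.sigma' (i + 1)))
  else 0

/-- The largest step length. -/
def maxStep : ℝ :=
  (Finset.Icc 1 X.m).sup' (Finset.nonempty_Icc.mpr X.one_le) X.step

/-- The smallest (positive) step length. -/
def minStep : ℝ :=
  (Finset.Icc 1 X.m).inf' (Finset.nonempty_Icc.mpr X.one_le) X.step

/-- The index `r ∈ {1, …, m}` of the subinterval `[x (r - 1), x r]` that contains `t`
(the right-hand one at an interior knot). -/
def cell (t : ℝ) : ℕ := 1 + ((Finset.Ico 1 X.m).filter (fun k => X.x k ≤ t)).card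

/-- The local coordinate `u = (t - x (r - 1)) / h r ∈ [0, 1]` of `t` in its subinterval. -/
def loc (t : ℝ) : ℝ := (t - X.knot (X.cell t - 1)) / X.step (X.cell t)

/-- The Bernstein coefficients `bb i r 0, bb i r 1, bb i r 2` on `[x (r - 1), x r]` (`1 ≤ r ≤ m`)
of the univariate quadratic B-spline `N i`, `0 ≤ i ≤ m + 1`, for the knot sequence in which
`x 0` and `x m` are triple and the other knots are simple. The support of `N i` is
`[x (i - 2), x (i + 1)] ∩ [x 0, x m]`. -/
def bb (i r : ℕ) : Fin 3 → ℝ :=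
  if i + 1 = r then ![X.sigma r, 0, 0]
  else if i = r then ![X.sigma' r, 1, X.sigma (r + 1)]
  else if i = r + 1 then ![0, 0, X.sigma' (r + 1)]
  else 0

end Knots

/-- The quadratic polynomial on a triangle with Bernstein-Bézier coefficients `c₁ c₂ c₃` at the
vertices and `e₁₂ e₁₃ e₂₃` at the edges, in barycentric coordinates `l₁ l₂ l₃`. -/
def bernstein (c₁ c₂ c₃ e₁₂ e₁₃ e₂₃ l₁ l₂ l₃ : ℝ) : ℝ :=
  c₁ * l₁ ^ 2 + c₂ * l₂ ^ 2 + c₃ * l₃ ^ 2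
    + 2 * e₁₂ * l₁ * l₂ + 2 * e₁₃ * l₁ * l₃ + 2 * e₂₃ * l₂ * l₃

/-- The `C¹` piecewise quadratic function on the unit square, cut by its two diagonals into four
triangles, whose Bernstein-Bézier coefficients on the boundary of the square are those of the
tensor product of the two univariate quadratics with Bernstein coefficients `p` and `q`.
By the `C¹` conditions across the diagonals, the coefficient on a half-diagonal is the mean of the
coefficients on the two edges that meet in its corner, and the coefficient at the center is the mean
of the four coefficients on the half-diagonals. -/
def patch (p q : Fin 3 → ℝ) (u v : ℝ) : ℝ :=
  let d₀₀ := (p 1 * q 0 + p 0 * q 1) / 2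
  let d₁₀ := (p 1 * q 0 + p 2 * q 1) / 2
  let d₀₁ := (p 1 * q 2 + p 0 * q 1) / 2
  let d₁₁ := (p 1 * q 2 + p 2 * q 1) / 2
  let z := (d₀₀ + d₁₀ + d₀₁ + d₁₁) / 4
  if v ≤ u then
    if u + v ≤ 1 then
      -- lower triangle: corners (0,0), (1,0) and the center
      bernstein (p 0 * q 0) (p 2 * q 0) z (p 1 * q 0) d₀₀ d₁₀ (1 - u - v) (u - v) (2 * v)
    else
      -- right triangle: corners (1,0), (1,1) and the center
      bernstein (p 2 * q 0) (p 2 * q 2) z (p 2 * q 1) d₁₀ d₁₁ (u - v) (u + v - 1) (2 * (1 - u))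
  else
    if u + v ≤ 1 then
      -- left triangle: corners (0,0), (0,1) and the center
      bernstein (p 0 * q 0) (p 0 * q 2) z (p 0 * q 1) d₀₀ d₀₁ (1 - u - v) (v - u) (2 * u)
    else
      -- upper triangle: corners (0,1), (1,1) and the center
      bernstein (p 0 * q 2) (p 2 * q 2) z (p 1 * q 2) d₀₁ d₁₁ (v - u) (u + v - 1) (2 * (1 - v))

/-- The rectangle `Ω = [x 0, x m] × [y 0, y n]`. -/
def Omega (X Y : Knots) : Set (ℝ × ℝ) := X.segment ×ˢ Y.segment

/-- The `C¹` quadratic B-spline `B i j`, `0 ≤ i ≤ m + 1`, `0 ≤ j ≤ n + 1`, on the criss-cross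
triangulation of `Ω`; only its values on `Ω` matter. It is the `C¹` piecewise quadratic function that
coincides on all grid lines `x = x k` and `y = y l`, together with its gradient at all vertices
`(x k, y l)`, with the tensor product `N i (x) * N j (y)` of univariate quadratic B-splines. -/
def B (X Y : Knots) (i j : ℕ) (P : ℝ × ℝ) : ℝ :=
  patch (X.bb i (X.cell P.1)) (Y.bb j (Y.cell P.2)) (X.loc P.1) (Y.loc P.2)

/-- The coefficient functionals of the quasi-interpolant `S₂`. For `i = 0` the coefficient of the
value at `M (i - 1) j` vanishes, and similarly for the other indices outside the range. -/
def muS (X Y : Knots) (f : ℝ × ℝ → ℝ) (i j : ℕ) : ℝ :=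
  (1 - (X.coefA i + X.coefC i + Y.coefA j + Y.coefC j)) * f (X.mid i, Y.mid j)
    + X.coefA i * f (X.mid (i - 1), Y.mid j) + X.coefC i * f (X.mid (i + 1), Y.mid j)
    + Y.coefA j * f (X.mid i, Y.mid (j - 1)) + Y.coefC j * f (X.mid i, Y.mid (j + 1))

/-- The coefficient functionals of the modified Chui-Wang quasi-interpolant `W₂*`. -/
def muW (X Y : Knots) (f : ℝ × ℝ → ℝ) (i j : ℕ) : ℝ :=
  2 * f (X.mid i, Y.mid j)
    - (f (X.knot (i - 1), Y.knot (j - 1)) + f (X.knot (i - 1), Y.knot j)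
      + f (X.knot i, Y.knot (j - 1)) + f (X.knot i, Y.knot j)) / 4

/-- The spline quasi-interpolant `S₂ f`. -/
def S2 (X Y : Knots) (f : ℝ × ℝ → ℝ) (P : ℝ × ℝ) : ℝ :=
  ∑ i ∈ Finset.range (X.m + 2), ∑ j ∈ Finset.range (Y.m + 2), muS X Y f i j * B X Y i j P

/-- The spline quasi-interpolant `W₂* f`. -/
def W2star (X Y : Knots) (f : ℝ × ℝ → ℝ) (P : ℝ × ℝ) : ℝ :=
  ∑ i ∈ Finset.range (X.m + 2), ∑ j ∈ Finset.range (Y.m + 2), muW X Y f i j * B X Y i j P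

/-- `h = max {h i, k j}`. -/
def meshMax (X Y : Knots) : ℝ := max X.maxStep Y.maxStep

/-- `δ = min {h i, k j}`. -/
def meshMin (X Y : Knots) : ℝ := min X.minStep Y.minStep

/-- The partial derivative `D^α f = ∂^(α₁ + α₂) f / ∂x^α₁ ∂y^α₂` on a set `U` with unique
derivatives, one-sided at the boundary of `U`. -/
def partialD (U : Set (ℝ × ℝ)) (α : ℕ × ℕ) (f : ℝ × ℝ → ℝ) : ℝ × ℝ → ℝ :=
  (fun g P => fderivWithin ℝ g U P (1, 0))^[α.1]
    ((fun g P => fderivWithin ℝ g U P (0, 1))^[α.2] f)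

/-- The modulus of continuity of `ψ` on `U`, for the Euclidean distance. -/
def modulus (U : Set (ℝ × ℝ)) (ψ : ℝ × ℝ → ℝ) (t : ℝ) : ℝ :=
  sSup {w | ∃ M ∈ U, ∃ P ∈ U,
    Real.sqrt ((M.1 - P.1) ^ 2 + (M.2 - P.2) ^ 2) ≤ t ∧ w = |ψ M - ψ P|}

/-- The supremum norm over `U`. -/
def supNorm (U : Set (ℝ × ℝ)) (ψ : ℝ × ℝ → ℝ) : ℝ := sSup ((fun P => |ψ P|) '' U)

/-- `ω(D^s f, t)`, the maximum of `ω(D^α f, t)` over `|α| = s`. -/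
def modulusD (U : Set (ℝ × ℝ)) (s : ℕ) (f : ℝ × ℝ → ℝ) (t : ℝ) : ℝ :=
  (Finset.HasAntidiagonal.antidiagonal s).sup' ⟨(0, s), by simp⟩ (fun α => modulus U (partialD U α f) t)

/-- `‖D^s f‖`, the maximum of the supremum norms of `D^α f` over `|α| = s`. -/
def normD (U : Set (ℝ × ℝ)) (s : ℕ) (f : ℝ × ℝ → ℝ) : ℝ :=
  (Finset.HasAntidiagonal.antidiagonal s).sup' ⟨(0, s), by simp⟩ (fun α => supNorm U (partialD U α f))

/-- The function `g` is of class `C¹` on `U` and `‖D^α f - D^α g‖ ≤ ε` (supremum norm over `U`)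
for `|α| = 1`. -/
def FirstDerivError (U : Set (ℝ × ℝ)) (f g : ℝ × ℝ → ℝ) (ε : ℝ) : Prop :=
  ContDiffOn ℝ 1 g U ∧
    ∀ α : ℕ × ℕ, α.1 + α.2 = 1 → ∀ P ∈ U, |partialD U α f P - partialD U α g P| ≤ ε

end CrissCross

end

open CrissCross

/-! ### Knots, steps and midpoints. -/

namespace CrissCross
namespace Knots

/-! Both quasi-interpolants are splines `∑ c i j * B i j`, and the error of the first derivatives is
read off from the differences of the coefficients.

On a grid cell the `x`-derivative of a spline is a convex combination of the difference quotients `D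
i j = (c (i+1) j - c i j) / (s (i+1) - s i)`. If `D i j` is attached to the point `(x i, t j)`, the
same weights reproduce affine functions (`splineDeriv_eq`, `abs_splineDeriv_sub_le`). So it suffices
that `D i j` be close to the first-order Taylor polynomial of `∂f/∂x` at the evaluation point.

On a quadratic polynomial `p` both functionals take the value `p (s i, t j) - p_xx h_i² / 8 - p_yy
k_j² / 8`. Consequently the difference of the values at `(i+1, j)` and `(i, j)` is exactly `p_x (x
i, t j)` times the distance of the midpoints (`quadPoly_mid_sub`). Applied to the Taylor polynomial
of `f` at `(x i, t j)`, this leaves only Taylor remainders. With `η = h / 2`, and `e` a bound for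
the variation of the second derivatives over a distance `η`, they contribute at most `K η² e`, where
`K = 16` for `W₂*` and `K = 57` for `S₂`. Dividing by a midpoint distance of at least `δ / 2` and
adding the Taylor error of `∂f/∂x`, at most `25 η e`, gives the bound `(2 K η / δ + 25) η e`. Part
(i) takes `e = ω(D²f, η)`, part (ii) takes `e = η ‖D³f‖`. The `y`-derivative follows by exchanging
the coordinates.

The `C¹` property holds because a patch is a polynomial in `u`, `v` and the functions `s|s|`, `d|d|`
of the two diagonals, while values and gradients of neighbouring patches agree on their common edge.
-/

theorem knot_of_le (X : Knots) {i : ℕ} (h : i ≤ X.m) : X.knot i = X.x i := by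
  simp [knot, min_eq_left h]

theorem knot_lt_succ (X : Knots) {i : ℕ} (h : i < X.m) : X.knot i < X.knot (i + 1) := by
  rw [X.knot_of_le h.le, X.knot_of_le h]
  exact X.lt_succ i h

theorem knot_of_ge (X : Knots) {i : ℕ} (h : X.m ≤ i) : X.knot i = X.x X.m := by
  simp [knot, min_eq_right h]

theorem knot_mono (X : Knots) : Monotone X.knot := by
  refine monotone_nat_of_le_succ fun i => ?_
  rcases lt_or_ge i X.m with h | h
  · exact (X.knot_lt_succ h).le
  · rw [X.knot_of_ge h, X.knot_of_ge (h.trans i.le_succ)]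

theorem knot_mem (X : Knots) (i : ℕ) : X.knot i ∈ X.segment := by
  constructor
  · rw [← X.knot_of_le (Nat.zero_le _)]
    exact X.knot_mono (Nat.zero_le i)
  · rw [← X.knot_of_ge (le_max_left X.m i)]
    exact X.knot_mono (le_max_right _ _)

theorem mid_mem (X : Knots) (i : ℕ) : X.mid i ∈ X.segment := by
  have h₁ := X.knot_mem (i - 1)
  have h₂ := X.knot_mem i
  simp only [segment, Set.mem_Icc, mid] at *
  constructor <;> linarith [h₁.1, h₁.2, h₂.1, h₂.2]

theorem step_nonneg (X : Knots) (i : ℕ) : 0 ≤ X.step i :=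
  sub_nonneg.mpr (X.knot_mono (Nat.sub_le i 1))

theorem step_zero (X : Knots) : X.step 0 = 0 := by simp [step]

theorem step_succ (X : Knots) (i : ℕ) : X.step (i + 1) = X.knot (i + 1) - X.knot i := rfl

theorem mid_succ (X : Knots) (i : ℕ) : X.mid (i + 1) = (X.knot i + X.knot (i + 1)) / 2 := rfl

theorem step_of_gt (X : Knots) {i : ℕ} (h : X.m < i) : X.step i = 0 := by
  rw [step, X.knot_of_ge h.le, X.knot_of_ge (Nat.le_sub_one_of_lt h), sub_self]

theorem step_succ_pos (X : Knots) {i : ℕ} (h : i < X.m) : 0 < X.step (i + 1) :=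
  sub_pos.mpr (X.knot_lt_succ h)

theorem step_le_maxStep (X : Knots) (i : ℕ) : X.step i ≤ X.maxStep := by
  have key : ∀ k ∈ Finset.Icc 1 X.m, X.step k ≤ X.maxStep := fun k hk =>
    Finset.le_sup' X.step hk
  by_cases hi : i ∈ Finset.Icc 1 X.m
  · exact key i hi
  · have h0 : X.step i = 0 := by
      rw [Finset.mem_Icc] at hi
      rcases Nat.eq_zero_or_pos i with rfl | h
      · exact X.step_zero
      · exact X.step_of_gt (by omega)
    rw [h0]
    exact (X.step_nonneg 1).trans (key 1 (Finset.mem_Icc.mpr ⟨le_rfl, X.one_le⟩))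

theorem minStep_le_step_succ (X : Knots) {i : ℕ} (h : i < X.m) : X.minStep ≤ X.step (i + 1) :=
  Finset.inf'_le X.step (Finset.mem_Icc.mpr ⟨by omega, h⟩)

theorem minStep_pos (X : Knots) : 0 < X.minStep := by
  rw [minStep, Finset.lt_inf'_iff]
  intro i hi
  obtain ⟨h₁, h₂⟩ := Finset.mem_Icc.mp hi
  obtain ⟨k, rfl⟩ := Nat.exists_eq_add_of_le' h₁
  exact X.step_succ_pos h₂

theorem minStep_le_maxStep (X : Knots) : X.minStep ≤ X.maxStep :=
  (X.minStep_le_step_succ X.one_le).trans (X.step_le_maxStep _)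

theorem mid_sub_mid (X : Knots) (i : ℕ) :
    X.mid (i + 1) - X.mid i = (X.step i + X.step (i + 1)) / 2 := by
  rw [mid_succ, step_succ, mid, step]
  ring

theorem minStep_le_step_add_step (X : Knots) {i : ℕ} (h : i ≤ X.m) :
    X.minStep ≤ X.step i + X.step (i + 1) := by
  rcases Nat.eq_zero_or_pos i with rfl | hi
  · rw [step_zero, zero_add]
    exact X.minStep_le_step_succ X.one_le
  · obtain ⟨k, rfl⟩ := Nat.exists_eq_add_of_le' hi
    linarith [X.minStep_le_step_succ (i := k) h, X.step_nonneg (k + 1 + 1)]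

theorem step_add_step_pos (X : Knots) {i : ℕ} (h : i ≤ X.m) :
    0 < X.step i + X.step (i + 1) :=
  X.minStep_pos.trans_le (X.minStep_le_step_add_step h)

theorem sigma_nonneg (X : Knots) (i : ℕ) : 0 ≤ X.sigma i :=
  div_nonneg (X.step_nonneg _) (add_nonneg (X.step_nonneg _) (X.step_nonneg _))

theorem sigma'_nonneg (X : Knots) (i : ℕ) : 0 ≤ X.sigma' i :=
  div_nonneg (X.step_nonneg _) (add_nonneg (X.step_nonneg _) (X.step_nonneg _))

theorem sigma_succ (X : Knots) (i : ℕ) :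
    X.sigma (i + 1) = X.step (i + 1) / (X.step i + X.step (i + 1)) := rfl

theorem sigma'_succ (X : Knots) (i : ℕ) :
    X.sigma' (i + 1) = X.step i / (X.step i + X.step (i + 1)) := rfl

theorem sigma_add_sigma' (X : Knots) {i : ℕ} (h : i ≤ X.m) :
    X.sigma (i + 1) + X.sigma' (i + 1) = 1 := by
  have := X.step_add_step_pos h
  rw [sigma_succ, sigma'_succ]
  field_simp
  ring

/-- The knot `x i` is the convex combination of the neighbouring midpoints. -/
theorem sigma_mul_mid (X : Knots) {i : ℕ} (h : i ≤ X.m) :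
    X.sigma (i + 1) * X.mid i + X.sigma' (i + 1) * X.mid (i + 1) = X.knot i := by
  have := (X.step_add_step_pos h).ne'
  have h₁ : X.mid i = X.knot i - X.step i / 2 := by rw [mid, step]; ring
  have h₂ : X.mid (i + 1) = X.knot i + X.step (i + 1) / 2 := by rw [mid_succ, step_succ]; ring
  rw [sigma_succ, sigma'_succ, h₁, h₂]
  field_simp
  ring

theorem mid_eq_sub (X : Knots) (i : ℕ) : X.mid i = X.knot i - X.step i / 2 := by
  rw [mid, step]; ring

theorem mid_succ_eq_add (X : Knots) (i : ℕ) :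
    X.mid (i + 1) = X.knot i + X.step (i + 1) / 2 := by
  rw [mid_succ, step_succ]; ring

/-! ### The coefficients of the functionals of `S₂` -/

theorem coefA_nonpos (X : Knots) (i : ℕ) : X.coefA i ≤ 0 := by
  have h₁ := X.sigma_nonneg i
  have h₂ := X.sigma'_nonneg (i + 1)
  unfold coefA
  split_ifs
  · have : 0 ≤ X.sigma i ^ 2 * X.sigma' (i + 1) / (X.sigma i + X.sigma' (i + 1)) := by positivity
    linarith
  · exact le_rfl

theorem coefC_nonpos (X : Knots) (i : ℕ) : X.coefC i ≤ 0 := by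
  have h₁ := X.sigma_nonneg i
  have h₂ := X.sigma'_nonneg (i + 1)
  unfold coefC
  split_ifs
  · have : 0 ≤ X.sigma i * X.sigma' (i + 1) ^ 2 / (X.sigma i + X.sigma' (i + 1)) := by positivity
    linarith
  · exact le_rfl

/-- The sum collapses to `-(σ i * σ' (i + 1))`, a product of two numbers in `[0, 1]`. This keeps the
central weight of `muS` between `1` and `3`. -/
theorem neg_one_le_coefA_add_coefC (X : Knots) (i : ℕ) : -1 ≤ X.coefA i + X.coefC i := by
  unfold coefA coefC
  split_ifs with h
  · have h₁ := X.sigma_nonneg i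
    have h₂ := X.sigma'_nonneg (i + 1)
    obtain ⟨k, rfl⟩ := Nat.exists_eq_add_of_le' h.1
    have h₃ := X.sigma_add_sigma' (i := k) (by omega)
    have h₄ := X.sigma_add_sigma' h.2
    have h₅ := X.sigma'_nonneg (k + 1)
    have h₆ := X.sigma_nonneg (k + 1 + 1)
    have h₇ : 0 < X.sigma (k + 1) := by
      rw [sigma_succ]
      exact div_pos (X.step_succ_pos h.2) (X.step_add_step_pos (by omega))
    generalize X.sigma (k + 1) = s at *
    generalize X.sigma' (k + 1 + 1) = t at *
    have : -(s ^ 2 * t / (s + t)) + -(s * t ^ 2 / (s + t)) = -(s * t) := by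
      field_simp
      ring
    rw [this]
    nlinarith
  · norm_num

/-- These two moments determine how `muS` acts on quadratics. The second one makes it agree there
with `muW`. -/
theorem coefA_coefC_moments (X : Knots) (i : ℕ) (hi : i ≤ X.m + 1) :
    X.coefA i * (X.mid (i - 1) - X.mid i) + X.coefC i * (X.mid (i + 1) - X.mid i) = 0 ∧
    X.coefA i * (X.mid (i - 1) - X.mid i) ^ 2 + X.coefC i * (X.mid (i + 1) - X.mid i) ^ 2
      = -(X.step i ^ 2 / 4) := by
  unfold coefA coefC
  split_ifs with h
  · obtain ⟨k, rfl⟩ := Nat.exists_eq_add_of_le' h.1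
    have e₁ : X.mid (k + 1 - 1) - X.mid (k + 1) = -((X.step k + X.step (k + 1)) / 2) := by
      rw [← mid_sub_mid, Nat.add_sub_cancel]; ring
    have p₁ := X.step_add_step_pos (i := k) (by omega)
    have p₂ := X.step_add_step_pos h.2
    have p₃ := X.step_succ_pos (i := k) h.2
    rw [e₁, mid_sub_mid, sigma_succ, sigma'_succ]
    generalize X.step (k + 1) = b at *
    have hp : 0 < b / (X.step k + b) + b / (b + X.step (k + 1 + 1)) := by positivity
    have n₁ := p₁.ne'
    have n₂ := p₂.ne'
    have n₄ : X.step k + b + (b + X.step (k + 1 + 1)) ≠ 0 := by positivity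
    generalize X.step k = a at *
    generalize X.step (k + 1 + 1) = c at *
    have hs : b / (a + b) + b / (b + c) = b * (a + b + (b + c)) / ((a + b) * (b + c)) := by
      field_simp
      ring
    rw [hs]
    constructor
    · field_simp
      ring
    · field_simp
      ring
  -- At the two end indices the coefficients are set to zero, consistently with a vanishing step.
  · have : X.step i = 0 := by
      rcases Nat.eq_zero_or_pos i with rfl | h'
      · exact X.step_zero
      · exact X.step_of_gt (by omega)
    simp [this]

/-! ### Subintervals -/

theorem exists_cell (X : Knots) {t : ℝ} (ht : t ∈ X.segment) :
    ∃ r < X.m, t ∈ Set.Icc (X.knot r) (X.knot (r + 1)) := by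
  have hex : ∃ r, t ≤ X.knot (r + 1) := ⟨X.m, by rw [X.knot_of_ge (Nat.le_succ _)]; exact ht.2⟩
  classical
  have hm : t ≤ X.knot (X.m - 1 + 1) := by
    rw [Nat.sub_add_cancel X.one_le, X.knot_of_le le_rfl]; exact ht.2
  have hle := Nat.find_min' hex hm
  have h1 := X.one_le
  refine ⟨Nat.find hex, by omega, ?_, Nat.find_spec hex⟩
  rcases Nat.eq_zero_or_pos (Nat.find hex) with h | h
  · rw [h, X.knot_of_le (Nat.zero_le _)]; exact ht.1
  · have := Nat.find_min hex (m := Nat.find hex - 1) (by omega)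
    rw [Nat.sub_add_cancel h] at this
    exact (not_le.mp this).le

/-- `cell` counts the interior knots not exceeding `t`. On a closed subinterval the count can thus
deviate only at its right end, and only if that end is not the last knot. -/
theorem cell_eq (X : Knots) {t : ℝ} {r : ℕ} (hr : r < X.m)
    (ht : t ∈ Set.Icc (X.knot r) (X.knot (r + 1))) :
    X.cell t = r + 1 ∨ (r + 1 < X.m ∧ t = X.knot (r + 1) ∧ X.cell t = r + 2) := by
  have card : ∀ k, 1 ≤ k → (∀ j < X.m, X.x j ≤ t ↔ j < k) → k ≤ X.m → X.cell t = k := by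
    intro k hk h hkm
    have : (Finset.Ico 1 X.m).filter (fun j => X.x j ≤ t) = Finset.Ico 1 k := by
      ext j
      simp only [Finset.mem_filter, Finset.mem_Ico]
      constructor
      · rintro ⟨⟨h₁, h₂⟩, h₃⟩
        exact ⟨h₁, (h j h₂).mp h₃⟩
      · rintro ⟨h₁, h₂⟩
        exact ⟨⟨h₁, by omega⟩, (h j (by omega)).mpr h₂⟩
    rw [cell, this, Nat.card_Ico]
    omega
  by_cases hc : r + 1 < X.m ∧ t = X.knot (r + 1)
  · refine Or.inr ⟨hc.1, hc.2, card (r + 2) (by omega) (fun j hj => ?_) hc.1⟩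
    rw [← X.knot_of_le hj.le, hc.2]
    constructor
    · intro h
      by_contra hcon
      have := X.knot_mono (show r + 2 ≤ j by omega)
      linarith [X.knot_lt_succ hc.1]
    · intro h
      exact X.knot_mono (by omega)
  · refine Or.inl (card (r + 1) (by omega) (fun j hj => ?_) hr)
    rw [← X.knot_of_le hj.le]
    constructor
    · intro h
      by_contra hcon
      have h₁ := X.knot_mono (show r + 1 ≤ j by omega)
      exact hc ⟨by omega, le_antisymm ht.2 (h₁.trans h)⟩
    · intro h
      exact (X.knot_mono (by omega)).trans ht.1

end Knots
end CrissCross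

/-! ### The quadratic patch on the unit square and the gluing of patches. -/

namespace CrissCross

open Knots

/-- The linear form `(x, y) ↦ a x + b y`. -/
def linForm (a b : ℝ) : ℝ × ℝ →L[ℝ] ℝ :=
  a • ContinuousLinearMap.fst ℝ ℝ ℝ + b • ContinuousLinearMap.snd ℝ ℝ ℝ

theorem linForm_apply (a b : ℝ) (d : ℝ × ℝ) : linForm a b d = a * d.1 + b * d.2 := by
  simp [linForm]

/-- Away from `0` the function is `±s²`; at `0` the derivative exists because `2|s|` extends
continuously. This is the source of smoothness across the diagonals. -/
theorem hasDerivAt_mul_abs (t : ℝ) : HasDerivAt (fun s : ℝ => s * |s|) (2 * |t|) t := by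
  have key : ∀ y : ℝ, y ≠ 0 → HasDerivAt (fun s : ℝ => s * |s|) (2 * |y|) y := by
    intro y hy
    have h := (hasDerivAt_id y).mul (hasDerivAt_abs hy)
    refine h.congr_deriv ?_
    rcases lt_or_gt_of_ne hy with h | h
    · simp [h, abs_of_neg h]; ring
    · simp [h, abs_of_pos h]; ring
  rcases eq_or_ne t 0 with rfl | ht
  · exact hasDerivAt_of_hasDerivAt_of_ne key (by fun_prop) (by fun_prop)
  · exact key t ht

/-- The derivative of `patch p q` in the first variable: it is linear on each of the four triangles,
and therefore the interpolant of its values at the corners and at the center. -/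
noncomputable def patchDeriv (p q : Fin 3 → ℝ) (u v : ℝ) : ℝ :=
  2 * (p 1 - p 0) * ((|u + v - 1| - (u + v - 1)) / 2 * q 0 + (|u - v| - (u - v)) / 2 * q 2
      + (1 - |u + v - 1| - |u - v|) / 2 * q 1)
    + 2 * (p 2 - p 1) * ((|u - v| + (u - v)) / 2 * q 0 + (|u + v - 1| + (u + v - 1)) / 2 * q 2
      + (1 - |u + v - 1| - |u - v|) / 2 * q 1)

/-- The piecewise quadratic `patch` in terms of the two truncated squares of the diagonals. -/
theorem patch_eq (p q : Fin 3 → ℝ) (u v : ℝ) :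
    patch p q u v =
      let a := (p 0 + 2 * p 1 + p 2) / 4
      let b := (p 2 - p 0) / 2
      let c := (p 0 - 2 * p 1 + p 2) / 4
      let a' := (q 0 + 2 * q 1 + q 2) / 4
      let b' := (q 2 - q 0) / 2
      let c' := (q 0 - 2 * q 1 + q 2) / 4
      let s := (u + v - 1) * |u + v - 1|
      let d := (u - v) * |u - v|
      (a + b * (2 * u - 1) + c * (2 * u - 1) ^ 2) * a'
        + a * (b' * (2 * v - 1) + c' * (2 * v - 1) ^ 2)
        + b * b' * (2 * u - 1) * (2 * v - 1)
        + b * c' * (2 * (s + d) - (2 * u - 1)) + c * b' * (2 * (s - d) - (2 * v - 1))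
        + c * c' * ((2 * u - 1) ^ 2 + (2 * v - 1) ^ 2 - 1) := by
  unfold patch bernstein
  dsimp only
  split_ifs with h₁ h₂ h₂
  · rw [abs_of_nonneg (sub_nonneg.mpr h₁), abs_of_nonpos (by linarith : u + v - 1 ≤ 0)]; ring
  · rw [abs_of_nonneg (sub_nonneg.mpr h₁), abs_of_nonneg (by linarith : 0 ≤ u + v - 1)]; ring
  · rw [abs_of_nonpos (by linarith : u - v ≤ 0), abs_of_nonpos (by linarith : u + v - 1 ≤ 0)]; ring
  · rw [abs_of_nonpos (by linarith : u - v ≤ 0), abs_of_nonneg (by linarith : 0 ≤ u + v - 1)]; ring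

theorem patch_comm (p q : Fin 3 → ℝ) (u v : ℝ) : patch p q u v = patch q p v u := by
  rw [patch_eq, patch_eq, abs_sub_comm v u, add_comm v u]
  ring

/-- The closed form `patch_eq` is differentiated termwise, so no case distinction between triangles
or on the diagonals arises. -/
theorem hasFDerivAt_patch (p q : Fin 3 → ℝ) (P : ℝ × ℝ) :
    HasFDerivAt (fun P : ℝ × ℝ => patch p q P.1 P.2)
      (linForm (patchDeriv p q P.1 P.2) (patchDeriv q p P.2 P.1)) P := by
  have hu : HasFDerivAt (fun P : ℝ × ℝ => P.1) (linForm 1 0) P :=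
    hasFDerivAt_fst.congr_fderiv (by ext <;> simp [linForm])
  have hv : HasFDerivAt (fun P : ℝ × ℝ => P.2) (linForm 0 1) P :=
    hasFDerivAt_snd.congr_fderiv (by ext <;> simp [linForm])
  have hs := (hasDerivAt_mul_abs (P.1 + P.2 - 1)).comp_hasFDerivAt P ((hu.add hv).sub_const 1)
  have hd := (hasDerivAt_mul_abs (P.1 - P.2)).comp_hasFDerivAt P (hu.sub hv)
  have hU := (hu.const_mul 2).sub_const 1
  have hV := (hv.const_mul 2).sub_const 1
  have hU2 := hU.pow 2
  have hV2 := hV.pow 2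
  simp only [patch_eq]
  have h := (((((((hU.const_mul ((p 2 - p 0) / 2)).const_add ((p 0 + 2 * p 1 + p 2) / 4)).add
      (hU2.const_mul ((p 0 - 2 * p 1 + p 2) / 4))).mul_const ((q 0 + 2 * q 1 + q 2) / 4)).add
    (((hV.const_mul ((q 2 - q 0) / 2)).add
      (hV2.const_mul ((q 0 - 2 * q 1 + q 2) / 4))).const_mul ((p 0 + 2 * p 1 + p 2) / 4))).add
    ((hU.const_mul ((p 2 - p 0) / 2 * ((q 2 - q 0) / 2))).mul hV)).add
    ((((hs.add hd).const_mul 2).sub hU).const_mul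
      ((p 2 - p 0) / 2 * ((q 0 - 2 * q 1 + q 2) / 4)))).add
    ((((hs.sub hd).const_mul 2).sub hV).const_mul
      ((p 0 - 2 * p 1 + p 2) / 4 * ((q 2 - q 0) / 2)))
  have h' := h.add (((hU2.add hV2).sub_const 1).const_mul
    ((p 0 - 2 * p 1 + p 2) / 4 * ((q 0 - 2 * q 1 + q 2) / 4)))
  refine h'.congr_fderiv ?_
  ext
  · simp [linForm, patchDeriv, abs_sub_comm P.2 P.1, add_comm P.2 P.1]
    ring
  · simp [linForm, patchDeriv, abs_sub_comm P.2 P.1, add_comm P.2 P.1]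
    ring

theorem continuous_patchDeriv (p q : Fin 3 → ℝ) :
    Continuous fun P : ℝ × ℝ => patchDeriv p q P.1 P.2 := by
  unfold patchDeriv
  fun_prop

/-- On an edge the patch is the tensor product itself, so matching two patches becomes a univariate
question. -/
theorem patch_one_left (p q : Fin 3 → ℝ) {v : ℝ} (hv : v ∈ Set.Icc (0 : ℝ) 1) :
    patch p q 1 v = p 2 * (q 0 * (1 - v) ^ 2 + 2 * q 1 * v * (1 - v) + q 2 * v ^ 2) := by
  rw [patch_eq, abs_of_nonneg (by linarith [hv.1] : 0 ≤ 1 + v - 1),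
    abs_of_nonneg (by linarith [hv.2] : 0 ≤ 1 - v)]
  ring

theorem patch_zero_left (p q : Fin 3 → ℝ) {v : ℝ} (hv : v ∈ Set.Icc (0 : ℝ) 1) :
    patch p q 0 v = p 0 * (q 0 * (1 - v) ^ 2 + 2 * q 1 * v * (1 - v) + q 2 * v ^ 2) := by
  rw [patch_eq, abs_of_nonpos (by linarith [hv.2] : 0 + v - 1 ≤ 0),
    abs_of_nonpos (by linarith [hv.1] : 0 - v ≤ 0)]
  ring

/-- The normal derivative is linear along an edge and therefore involves only the corner values `q
0` and `q 2`. -/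
theorem patchDeriv_one_left (p q : Fin 3 → ℝ) {v : ℝ} (hv : v ∈ Set.Icc (0 : ℝ) 1) :
    patchDeriv p q 1 v = 2 * (p 2 - p 1) * ((1 - v) * q 0 + v * q 2) := by
  rw [patchDeriv, abs_of_nonneg (by linarith [hv.1] : 0 ≤ 1 + v - 1),
    abs_of_nonneg (by linarith [hv.2] : 0 ≤ 1 - v)]
  ring

theorem patchDeriv_zero_left (p q : Fin 3 → ℝ) {v : ℝ} (hv : v ∈ Set.Icc (0 : ℝ) 1) :
    patchDeriv p q 0 v = 2 * (p 1 - p 0) * ((1 - v) * q 0 + v * q 2) := by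
  rw [patchDeriv, abs_of_nonpos (by linarith [hv.2] : 0 + v - 1 ≤ 0),
    abs_of_nonpos (by linarith [hv.1] : 0 - v ≤ 0)]
  ring

theorem patchDeriv_one_right (p q : Fin 3 → ℝ) {u : ℝ} (hu : u ∈ Set.Icc (0 : ℝ) 1) :
    patchDeriv p q u 1 = 2 * ((1 - u) * (p 1 - p 0) + u * (p 2 - p 1)) * q 2 := by
  rw [patchDeriv, abs_of_nonneg (by linarith [hu.1] : 0 ≤ u + 1 - 1),
    abs_of_nonpos (by linarith [hu.2] : u - 1 ≤ 0)]
  ring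

theorem patchDeriv_zero_right (p q : Fin 3 → ℝ) {u : ℝ} (hu : u ∈ Set.Icc (0 : ℝ) 1) :
    patchDeriv p q u 0 = 2 * ((1 - u) * (p 1 - p 0) + u * (p 2 - p 1)) * q 0 := by
  rw [patchDeriv, abs_of_nonpos (by linarith [hu.2] : u + 0 - 1 ≤ 0),
    abs_of_nonneg (by linarith [hu.1] : 0 ≤ u - 0)]
  ring

/-! ### Functions given cell by cell -/

/-- The function that coincides with `Φ r q` on the cell `[x (r - 1), x r] × [y (q - 1), y q]`. -/
noncomputable def cellwise (X Y : Knots) (Φ : ℕ → ℕ → ℝ × ℝ → ℝ) (P : ℝ × ℝ) : ℝ :=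
  Φ (X.cell P.1) (Y.cell P.2) P

/-- The local coordinate in the subinterval `[x (r - 1), x r]`. -/
noncomputable def Knots.coord (X : Knots) (r : ℕ) (t : ℝ) : ℝ := (t - X.knot (r - 1)) / X.step r

/-- The subinterval `[x r, x (r + 1)]`. -/
def Knots.piece (X : Knots) (r : ℕ) : Set ℝ := Set.Icc (X.knot r) (X.knot (r + 1))

theorem Knots.coord_mem (X : Knots) {r : ℕ} (hr : r < X.m) {t : ℝ} (ht : t ∈ X.piece r) :
    X.coord (r + 1) t ∈ Set.Icc (0 : ℝ) 1 := by
  have h := X.step_succ_pos hr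
  have h₁ := ht.1
  have h₂ := ht.2
  rw [coord, Nat.add_sub_cancel]
  constructor
  · exact div_nonneg (by linarith) h.le
  · rw [div_le_one h, step_succ]
    linarith

theorem Knots.coord_right (X : Knots) {r : ℕ} (hr : r < X.m) :
    X.coord (r + 1) (X.knot (r + 1)) = 1 := by
  rw [coord, Nat.add_sub_cancel, ← step_succ, div_self (X.step_succ_pos hr).ne']

theorem Knots.coord_left (X : Knots) (r : ℕ) : X.coord (r + 1) (X.knot r) = 0 := by
  rw [coord, Nat.add_sub_cancel, sub_self, zero_div]

theorem Knots.coord_mul_step (X : Knots) {r : ℕ} (hr : r < X.m) (t : ℝ) :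
    X.coord (r + 1) t * X.step (r + 1) = t - X.knot r := by
  rw [coord, Nat.add_sub_cancel, div_mul_cancel₀ _ (X.step_succ_pos hr).ne']

/-- The local expressions `Φ r q` agree on the common edges of neighbouring cells. -/
structure Compatible (X Y : Knots) (Φ : ℕ → ℕ → ℝ × ℝ → ℝ) : Prop where
  left_right : ∀ r q t, r + 1 < X.m → q < Y.m → t ∈ Y.piece q →
    Φ (r + 1) (q + 1) (X.knot (r + 1), t) = Φ (r + 2) (q + 1) (X.knot (r + 1), t)
  down_up : ∀ r q t, r < X.m → q + 1 < Y.m → t ∈ X.piece r →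
    Φ (r + 1) (q + 1) (t, Y.knot (q + 1)) = Φ (r + 1) (q + 2) (t, Y.knot (q + 1))

/-- On grid lines `cell` may select the right or upper neighbour. Compatibility moves the index
back, one coordinate at a time, so that corners are covered too. -/
theorem cellwise_eq {X Y : Knots} {Φ : ℕ → ℕ → ℝ × ℝ → ℝ} (h : Compatible X Y Φ) {r q : ℕ}
    (hr : r < X.m) (hq : q < Y.m) {P : ℝ × ℝ} (hP : P ∈ X.piece r ×ˢ Y.piece q) :
    cellwise X Y Φ P = Φ (r + 1) (q + 1) P := by
  obtain ⟨s, t⟩ := P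
  obtain ⟨hs, ht⟩ := hP
  dsimp only at hs ht
  have key : ∀ r' < X.m, s ∈ X.piece r' →
      Φ (r' + 1) (Y.cell t) (s, t) = Φ (r' + 1) (q + 1) (s, t) := by
    intro r' hr' hs'
    rcases Y.cell_eq hq ht with e | ⟨hq', e, e'⟩
    · rw [e]
    · rw [e', e]
      exact (h.down_up r' q s hr' hq' hs').symm
  rw [cellwise]
  rcases X.cell_eq hr hs with e | ⟨hr', e, e'⟩
  · dsimp only
    rw [e, key r hr hs]
  · dsimp only
    have hs' : s ∈ X.piece (r + 1) := by
      rw [e]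
      exact ⟨le_rfl, X.knot_mono (Nat.le_succ _)⟩
    rw [e', key (r + 1) hr' hs', e]
    exact (h.left_right r q t hr' hq ht).symm

/-- The index set of the cells. -/
def cells (X Y : Knots) : Finset (ℕ × ℕ) := Finset.range X.m ×ˢ Finset.range Y.m

theorem Omega_subset_iUnion (X Y : Knots) :
    Omega X Y ⊆ ⋃ c ∈ cells X Y, X.piece c.1 ×ˢ Y.piece c.2 := by
  rintro P ⟨h₁, h₂⟩
  obtain ⟨r, hr, hr'⟩ := X.exists_cell h₁
  obtain ⟨q, hq, hq'⟩ := Y.exists_cell h₂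
  simp only [Set.mem_iUnion]
  exact ⟨(r, q), by simp [cells, hr, hq], hr', hq'⟩

theorem isClosed_cell (X Y : Knots) (c : ℕ × ℕ) : IsClosed (X.piece c.1 ×ˢ Y.piece c.2) :=
  isClosed_Icc.prod isClosed_Icc

/-- A closed set that misses `x` imposes no condition at `x`, and on the others the derivative is
the same. -/
theorem hasFDerivWithinAt_biUnion {ι E F : Type*} [NormedAddCommGroup E] [NormedSpace ℝ E]
    [NormedAddCommGroup F] [NormedSpace ℝ F] (s : Finset ι) {K : ι → Set E}
    (hK : ∀ i ∈ s, IsClosed (K i)) {f : E → F} {f' : E →L[ℝ] F} {x : E}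
    (h : ∀ i ∈ s, x ∈ K i → HasFDerivWithinAt f f' (K i) x) :
    HasFDerivWithinAt f f' (⋃ i ∈ s, K i) x := by
  classical
  induction s using Finset.induction_on with
  | empty => simp
  | insert a s _ ih =>
    rw [Finset.set_biUnion_insert]
    refine HasFDerivWithinAt.union ?_ (ih (fun i hi => hK i (Finset.mem_insert_of_mem hi))
      fun i hi => h i (Finset.mem_insert_of_mem hi))
    by_cases hx : x ∈ K a
    · exact h a (Finset.mem_insert_self _ _) hx
    · refine .of_notMem_closure ?_
      rwa [(hK a (Finset.mem_insert_self _ _)).closure_eq]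

theorem continuousOn_biUnion {ι E F : Type*} [TopologicalSpace E] [TopologicalSpace F]
    (s : Finset ι) {K : ι → Set E} (hK : ∀ i ∈ s, IsClosed (K i)) {f : E → F}
    (h : ∀ i ∈ s, ContinuousOn f (K i)) : ContinuousOn f (⋃ i ∈ s, K i) := by
  classical
  induction s using Finset.induction_on with
  | empty => simp
  | insert a s _ ih =>
    rw [Finset.set_biUnion_insert]
    have hs : ∀ i ∈ s, IsClosed (K i) := fun i hi => hK i (Finset.mem_insert_of_mem hi)
    exact (h a (Finset.mem_insert_self _ _)).union_of_isClosed
      (ih hs fun i hi => h i (Finset.mem_insert_of_mem hi))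
      (hK a (Finset.mem_insert_self _ _)) (s.finite_toSet.isClosed_biUnion hs)

theorem continuousOn_cellwise {X Y : Knots} {Φ : ℕ → ℕ → ℝ × ℝ → ℝ} (h : Compatible X Y Φ)
    (hΦ : ∀ r q, Continuous (Φ r q)) : ContinuousOn (cellwise X Y Φ) (Omega X Y) := by
  refine (continuousOn_biUnion (cells X Y) (fun c _ => isClosed_cell X Y c) fun c hc => ?_).mono
    (Omega_subset_iUnion X Y)
  obtain ⟨h₁, h₂⟩ := Finset.mem_product.mp hc
  exact (hΦ (c.1 + 1) (c.2 + 1)).continuousOn.congr fun P hP =>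
    cellwise_eq h (Finset.mem_range.mp h₁) (Finset.mem_range.mp h₂) hP

theorem hasFDerivWithinAt_cellwise {X Y : Knots} {Φ Φ₁ Φ₂ : ℕ → ℕ → ℝ × ℝ → ℝ}
    (h : Compatible X Y Φ) (h₁ : Compatible X Y Φ₁) (h₂ : Compatible X Y Φ₂)
    (hΦ : ∀ r q P, HasFDerivAt (Φ r q) (linForm (Φ₁ r q P) (Φ₂ r q P)) P) (P : ℝ × ℝ) :
    HasFDerivWithinAt (cellwise X Y Φ) (linForm (cellwise X Y Φ₁ P) (cellwise X Y Φ₂ P))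
      (Omega X Y) P := by
  refine (hasFDerivWithinAt_biUnion (cells X Y) (fun c _ => isClosed_cell X Y c)
    fun c hc hP => ?_).mono (Omega_subset_iUnion X Y)
  have hr := Finset.mem_range.mp (Finset.mem_product.mp hc).1
  have hq := Finset.mem_range.mp (Finset.mem_product.mp hc).2
  rw [cellwise_eq h₁ hr hq hP, cellwise_eq h₂ hr hq hP]
  exact (hΦ (c.1 + 1) (c.2 + 1) P).hasFDerivWithinAt.congr
    (fun Q hQ => cellwise_eq h hr hq hQ) (cellwise_eq h hr hq hP)

end CrissCross

/-! ### Derivatives of splines in terms of their coefficients. -/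

namespace CrissCross

open Knots

namespace Knots

theorem bb_succ (X : Knots) (i r : ℕ) : X.bb i (r + 1) =
    if i = r then ![X.sigma (r + 1), 0, 0]
    else if i = r + 1 then ![X.sigma' (r + 1), 1, X.sigma (r + 2)]
    else if i = r + 2 then ![0, 0, X.sigma' (r + 2)]
    else 0 := by
  simp only [bb, Nat.add_right_cancel_iff]

/-- Continuity of the univariate B-spline at a knot. -/
theorem bb_two_eq (X : Knots) (i r : ℕ) : X.bb i (r + 1) 2 = X.bb i (r + 2) 0 := by
  rw [bb_succ, show r + 2 = r + 1 + 1 from rfl, bb_succ]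
  rcases eq_or_ne i r with rfl | h₀
  · simp [show ¬ i = i + 1 + 1 by omega, show ¬ i = i + 1 + 2 by omega]
  rcases eq_or_ne i (r + 1) with rfl | h₁
  · simp
  rcases eq_or_ne i (r + 2) with rfl | h₂
  · simp
  simp [h₀, h₁, h₂, show r + 1 + 1 = r + 2 from rfl]
  split_ifs <;> rfl

/-- The B-splines in one variable are of class `C¹`. -/
theorem bb_slope_eq (X : Knots) (i : ℕ) {r : ℕ} (hr : r + 1 < X.m) :
    (X.bb i (r + 1) 2 - X.bb i (r + 1) 1) / X.step (r + 1) =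
      (X.bb i (r + 2) 1 - X.bb i (r + 2) 0) / X.step (r + 2) := by
  have p₁ := X.step_succ_pos (i := r) (by omega)
  have p₂ : 0 < X.step (r + 2) := X.step_succ_pos hr
  have e₁ : X.sigma (r + 2) = X.step (r + 2) / (X.step (r + 1) + X.step (r + 2)) := rfl
  have e₂ : X.sigma' (r + 2) = X.step (r + 1) / (X.step (r + 1) + X.step (r + 2)) := rfl
  rw [bb_succ, show r + 2 = r + 1 + 1 from rfl, bb_succ]
  rcases eq_or_ne i r with rfl | h₀
  · simp [show ¬ i = i + 1 + 1 by omega, show ¬ i = i + 1 + 2 by omega]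
  rcases eq_or_ne i (r + 1) with rfl | h₁
  · simp [e₁, show r + 1 + 1 = r + 2 from rfl]
    field_simp
    ring
  rcases eq_or_ne i (r + 2) with rfl | h₂
  · simp [e₂, show r + 1 + 1 = r + 2 from rfl]
    field_simp
    ring
  simp [h₀, h₁, h₂, show r + 1 + 1 = r + 2 from rfl]
  split_ifs <;> simp

/-- Only three B-splines live on a subinterval. The free weights `w₀ w₁ w₂` make the formula usable
for values and for slopes. -/
theorem sum_mul_bb (X : Knots) (g : ℕ → ℝ) (w₀ w₁ w₂ : ℝ) {r : ℕ} (hr : r < X.m) :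
    ∑ i ∈ Finset.range (X.m + 2),
        g i * (w₀ * X.bb i (r + 1) 0 + w₁ * X.bb i (r + 1) 1 + w₂ * X.bb i (r + 1) 2) =
      w₀ * (X.sigma (r + 1) * g r + X.sigma' (r + 1) * g (r + 1)) + w₁ * g (r + 1)
        + w₂ * (X.sigma (r + 2) * g (r + 1) + X.sigma' (r + 2) * g (r + 2)) := by
  have key : ∀ i, g i * (w₀ * X.bb i (r + 1) 0 + w₁ * X.bb i (r + 1) 1 + w₂ * X.bb i (r + 1) 2) =
      (if i = r then g r * (w₀ * X.sigma (r + 1)) else 0)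
      + (if i = r + 1 then g (r + 1) * (w₀ * X.sigma' (r + 1) + w₁ + w₂ * X.sigma (r + 2)) else 0)
      + (if i = r + 2 then g (r + 2) * (w₂ * X.sigma' (r + 2)) else 0) := by
    intro i
    rw [bb_succ]
    rcases eq_or_ne i r with rfl | h₀
    · simp
    rcases eq_or_ne i (r + 1) with rfl | h₁
    · simp
    rcases eq_or_ne i (r + 2) with rfl | h₂
    · simp
    simp [h₀, h₁, h₂]
  simp only [key, Finset.sum_add_distrib, Finset.sum_ite_eq', Finset.mem_range]
  rw [if_pos (by omega), if_pos (by omega), if_pos (by omega)]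
  ring

end Knots

theorem Compatible.swap {X Y : Knots} {Φ : ℕ → ℕ → ℝ × ℝ → ℝ} (h : Compatible Y X Φ) :
    Compatible X Y fun r q P => Φ q r P.swap :=
  ⟨fun r q t hr hq ht => h.down_up q r t hq hr ht, fun r q t hr hq ht => h.left_right q r t hq hr ht⟩

/-- The polynomial pieces of `B i j`. -/
noncomputable def pieceB (X Y : Knots) (i j r q : ℕ) (P : ℝ × ℝ) : ℝ :=
  patch (X.bb i r) (Y.bb j q) (X.coord r P.1) (Y.coord q P.2)

/-- The derivatives in `x` of the polynomial pieces of `B i j`. -/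
noncomputable def pieceDerivB (X Y : Knots) (i j r q : ℕ) (P : ℝ × ℝ) : ℝ :=
  patchDeriv (X.bb i r) (Y.bb j q) (X.coord r P.1) (Y.coord q P.2) / X.step r

theorem compatible_pieceB (X Y : Knots) (i j : ℕ) : Compatible X Y (pieceB X Y i j) := by
  have key : ∀ (X Y : Knots) (i j : ℕ) (r q : ℕ) (t : ℝ), r + 1 < X.m → q < Y.m → t ∈ Y.piece q →
      pieceB X Y i j (r + 1) (q + 1) (X.knot (r + 1), t) =
        pieceB X Y i j (r + 2) (q + 1) (X.knot (r + 1), t) := by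
    intro X Y i j r q t hr hq ht
    have hv := Y.coord_mem hq ht
    simp only [pieceB]
    rw [X.coord_right (by omega), X.coord_left, patch_one_left _ _ hv, patch_zero_left _ _ hv,
      X.bb_two_eq]
  refine ⟨key X Y i j, fun r q t hr hq ht => ?_⟩
  have := key Y X j i q r t hq hr ht
  simp only [pieceB] at this ⊢
  rw [patch_comm, this, patch_comm]

/-- Across a vertical line the `C¹` property of `N i` is needed. Across a horizontal line the
derivative is tangential and continuity of the other factor suffices. -/
theorem compatible_pieceDerivB (X Y : Knots) (i j : ℕ) :
    Compatible X Y (pieceDerivB X Y i j) := by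
  constructor
  · intro r q t hr hq ht
    have hv := Y.coord_mem hq ht
    have h := X.bb_slope_eq i hr
    simp only [pieceDerivB]
    rw [X.coord_right (by omega), X.coord_left, patchDeriv_one_left _ _ hv,
      patchDeriv_zero_left _ _ hv]
    linear_combination 2 * ((1 - Y.coord (q + 1) t) * Y.bb j (q + 1) 0
      + Y.coord (q + 1) t * Y.bb j (q + 1) 2) * h
  · intro r q t hr hq ht
    have hu := X.coord_mem hr ht
    simp only [pieceDerivB]
    rw [Y.coord_right (by omega), Y.coord_left, patchDeriv_one_right _ _ hu,
      patchDeriv_zero_right _ _ hu, Y.bb_two_eq]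

theorem hasFDerivAt_pieceB (X Y : Knots) (i j r q : ℕ) (P : ℝ × ℝ) :
    HasFDerivAt (pieceB X Y i j r q)
      (linForm (pieceDerivB X Y i j r q P) (pieceDerivB Y X j i q r P.swap)) P := by
  have hu : HasFDerivAt (fun P : ℝ × ℝ => X.coord r P.1) (linForm (1 / X.step r) 0) P := by
    have := ((hasFDerivAt_fst (𝕜 := ℝ) (p := P)).sub_const (X.knot (r - 1))).mul_const
      (X.step r)⁻¹
    refine this.congr_fderiv ?_
    ext <;> simp [linForm]
  have hv : HasFDerivAt (fun P : ℝ × ℝ => Y.coord q P.2) (linForm 0 (1 / Y.step q)) P := by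
    have := ((hasFDerivAt_snd (𝕜 := ℝ) (p := P)).sub_const (Y.knot (q - 1))).mul_const
      (Y.step q)⁻¹
    refine this.congr_fderiv ?_
    ext <;> simp [linForm]
  have h := (hasFDerivAt_patch (X.bb i r) (Y.bb j q)
    (X.coord r P.1, Y.coord q P.2)).comp P (hu.prodMk hv)
  refine h.congr_fderiv ?_
  ext <;> simp [linForm, pieceDerivB, div_eq_mul_inv]

theorem continuous_pieceDerivB (X Y : Knots) (i j r q : ℕ) :
    Continuous (pieceDerivB X Y i j r q) := by
  have hu : Continuous fun P : ℝ × ℝ => (X.coord r P.1, Y.coord q P.2) := by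
    unfold coord
    fun_prop
  exact ((continuous_patchDeriv (X.bb i r) (Y.bb j q)).comp hu).div_const _

/-- The spline with coefficients `c i j`. -/
noncomputable def spline (X Y : Knots) (c : ℕ → ℕ → ℝ) (P : ℝ × ℝ) : ℝ :=
  ∑ i ∈ Finset.range (X.m + 2), ∑ j ∈ Finset.range (Y.m + 2), c i j * B X Y i j P

/-- The derivative in `x` of the spline with coefficients `c i j`. -/
noncomputable def splineDeriv (X Y : Knots) (c : ℕ → ℕ → ℝ) (P : ℝ × ℝ) : ℝ :=
  ∑ i ∈ Finset.range (X.m + 2), ∑ j ∈ Finset.range (Y.m + 2),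
    c i j * cellwise X Y (pieceDerivB X Y i j) P

theorem continuousOn_splineDeriv (X Y : Knots) (c : ℕ → ℕ → ℝ) :
    ContinuousOn (splineDeriv X Y c) (Omega X Y) := by
  unfold splineDeriv
  refine continuousOn_finsetSum _ fun i _ => continuousOn_finsetSum _ fun j _ =>
    continuousOn_const.mul ?_
  exact continuousOn_cellwise (compatible_pieceDerivB X Y i j) (continuous_pieceDerivB X Y i j)

theorem hasFDerivWithinAt_spline (X Y : Knots) (c : ℕ → ℕ → ℝ) (P : ℝ × ℝ) :
    HasFDerivWithinAt (spline X Y c)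
      (linForm (splineDeriv X Y c P) (splineDeriv Y X (fun j i => c i j) P.swap))
      (Omega X Y) P := by
  have hB : ∀ i j, HasFDerivWithinAt (B X Y i j)
      (linForm (cellwise X Y (pieceDerivB X Y i j) P)
        (cellwise Y X (pieceDerivB Y X j i) P.swap)) (Omega X Y) P := fun i j =>
    hasFDerivWithinAt_cellwise (compatible_pieceB X Y i j) (compatible_pieceDerivB X Y i j)
      (compatible_pieceDerivB Y X j i).swap (hasFDerivAt_pieceB X Y i j) P
  have h := HasFDerivWithinAt.fun_sum (u := Finset.range (X.m + 2)) fun i _ =>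
    HasFDerivWithinAt.fun_sum (u := Finset.range (Y.m + 2)) fun j _ => (hB i j).const_mul (c i j)
  refine h.congr_fderiv ?_
  refine ContinuousLinearMap.ext fun d => ?_
  rw [linForm_apply, splineDeriv, splineDeriv, Finset.sum_comm (s := Finset.range (Y.m + 2))]
  simp only [_root_.sum_apply, _root_.smul_apply, linForm_apply,
    Finset.sum_mul, smul_eq_mul, ← Finset.sum_add_distrib]
  refine Finset.sum_congr rfl fun i _ => Finset.sum_congr rfl fun j _ => ?_
  ring

/-- The derivative of a spline on a cell, as a combination of differences of coefficients. -/
theorem splineDeriv_eq (X Y : Knots) (c : ℕ → ℕ → ℝ) {r q : ℕ} (hr : r < X.m) (hq : q < Y.m)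
    {P : ℝ × ℝ} (hP : P ∈ X.piece r ×ˢ Y.piece q) :
    splineDeriv X Y c P =
      let s := X.coord (r + 1) P.1 + Y.coord (q + 1) P.2 - 1
      let d := X.coord (r + 1) P.1 - Y.coord (q + 1) P.2
      let D := fun i j => (c (i + 1) j - c i j) / (X.mid (i + 1) - X.mid i)
      (|s| - s) / 2 * (Y.sigma (q + 1) * D r q + Y.sigma' (q + 1) * D r (q + 1))
        + (|d| - d) / 2 * (Y.sigma (q + 2) * D r (q + 1) + Y.sigma' (q + 2) * D r (q + 2))
        + (1 - |s| - |d|) / 2 * D r (q + 1)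
        + ((|d| + d) / 2 * (Y.sigma (q + 1) * D (r + 1) q + Y.sigma' (q + 1) * D (r + 1) (q + 1))
        + (|s| + s) / 2 *
          (Y.sigma (q + 2) * D (r + 1) (q + 1) + Y.sigma' (q + 2) * D (r + 1) (q + 2))
        + (1 - |s| - |d|) / 2 * D (r + 1) (q + 1)) := by
  have hcw : ∀ i j, cellwise X Y (pieceDerivB X Y i j) P = pieceDerivB X Y i j (r + 1) (q + 1) P :=
    fun i j => cellwise_eq (compatible_pieceDerivB X Y i j) hr hq hP
  simp only [splineDeriv, hcw, pieceDerivB, patchDeriv]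
  generalize X.coord (r + 1) P.1 + Y.coord (q + 1) P.2 - 1 = s
  generalize X.coord (r + 1) P.1 - Y.coord (q + 1) P.2 = d
  have inner : ∀ i, ∑ j ∈ Finset.range (Y.m + 2), c i j *
      ((2 * (X.bb i (r + 1) 1 - X.bb i (r + 1) 0) * ((|s| - s) / 2 * Y.bb j (q + 1) 0
        + (|d| - d) / 2 * Y.bb j (q + 1) 2 + (1 - |s| - |d|) / 2 * Y.bb j (q + 1) 1)
      + 2 * (X.bb i (r + 1) 2 - X.bb i (r + 1) 1) * ((|d| + d) / 2 * Y.bb j (q + 1) 0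
        + (|s| + s) / 2 * Y.bb j (q + 1) 2 + (1 - |s| - |d|) / 2 * Y.bb j (q + 1) 1))
        / X.step (r + 1)) = _ := fun i => by
    refine Eq.trans ?_ (Y.sum_mul_bb (c i)
      ((2 * (X.bb i (r + 1) 1 - X.bb i (r + 1) 0) * ((|s| - s) / 2)
        + 2 * (X.bb i (r + 1) 2 - X.bb i (r + 1) 1) * ((|d| + d) / 2)) / X.step (r + 1))
      ((2 * (X.bb i (r + 1) 1 - X.bb i (r + 1) 0) * ((1 - |s| - |d|) / 2)
        + 2 * (X.bb i (r + 1) 2 - X.bb i (r + 1) 1) * ((1 - |s| - |d|) / 2)) / X.step (r + 1))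
      ((2 * (X.bb i (r + 1) 1 - X.bb i (r + 1) 0) * ((|d| - d) / 2)
        + 2 * (X.bb i (r + 1) 2 - X.bb i (r + 1) 1) * ((|s| + s) / 2)) / X.step (r + 1)) hq)
    refine Finset.sum_congr rfl fun j _ => ?_
    ring
  simp only [inner]
  -- `G` and `H` collect the `y`-combinations that multiply the left slope `bb 1 - bb 0` and the
  -- right slope `bb 2 - bb 1`.
  let G := fun i => (|s| - s) / 2 * (Y.sigma (q + 1) * c i q + Y.sigma' (q + 1) * c i (q + 1))
    + (|d| - d) / 2 * (Y.sigma (q + 2) * c i (q + 1) + Y.sigma' (q + 2) * c i (q + 2))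
    + (1 - |s| - |d|) / 2 * c i (q + 1)
  let H := fun i => (|d| + d) / 2 * (Y.sigma (q + 1) * c i q + Y.sigma' (q + 1) * c i (q + 1))
    + (|s| + s) / 2 * (Y.sigma (q + 2) * c i (q + 1) + Y.sigma' (q + 2) * c i (q + 2))
    + (1 - |s| - |d|) / 2 * c i (q + 1)
  have hG := X.sum_mul_bb G (-(2 / X.step (r + 1))) (2 / X.step (r + 1)) 0 hr
  have hH := X.sum_mul_bb H 0 (-(2 / X.step (r + 1))) (2 / X.step (r + 1)) hr
  have e₁ : X.mid (r + 1) - X.mid r = (X.step r + X.step (r + 1)) / 2 := X.mid_sub_mid r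
  have e₂ : X.mid (r + 1 + 1) - X.mid (r + 1) = (X.step (r + 1) + X.step (r + 2)) / 2 :=
    X.mid_sub_mid (r + 1)
  have p₁ := X.step_succ_pos hr
  have p₂ := X.step_add_step_pos hr.le
  have p₃ : 0 < X.step (r + 1) + X.step (r + 2) := X.step_add_step_pos hr
  have s₁ : X.sigma' (r + 1) = 1 - X.sigma (r + 1) := by linarith [X.sigma_add_sigma' hr.le]
  have s₂ : X.sigma (r + 2) = 1 - X.sigma' (r + 2) := by
    linarith [X.sigma_add_sigma' (i := r + 1) hr]
  -- Here the step length turns into a midpoint distance, which yields difference quotients.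
  have s₃ : 2 / X.step (r + 1) * X.sigma (r + 1) = 1 / (X.mid (r + 1) - X.mid r) := by
    rw [e₁, sigma_succ]
    field_simp
  have s₄ : 2 / X.step (r + 1) * X.sigma' (r + 2) = 1 / (X.mid (r + 1 + 1) - X.mid (r + 1)) := by
    rw [e₂, show X.sigma' (r + 2) = X.step (r + 1) / (X.step (r + 1) + X.step (r + 2)) from rfl]
    field_simp
  rw [s₁] at hG
  rw [s₂] at hH
  have total : (G (r + 1) - G r) * (1 / (X.mid (r + 1) - X.mid r))
      + (H (r + 2) - H (r + 1)) * (1 / (X.mid (r + 1 + 1) - X.mid (r + 1))) =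
    ∑ i ∈ Finset.range (X.m + 2),
        G i * (-(2 / X.step (r + 1)) * X.bb i (r + 1) 0 + 2 / X.step (r + 1) * X.bb i (r + 1) 1
          + 0 * X.bb i (r + 1) 2)
    + ∑ i ∈ Finset.range (X.m + 2),
        H i * (0 * X.bb i (r + 1) 0 + -(2 / X.step (r + 1)) * X.bb i (r + 1) 1
          + 2 / X.step (r + 1) * X.bb i (r + 1) 2) := by
    rw [hG, hH, ← s₃, ← s₄]
    ring
  rw [← Finset.sum_add_distrib] at total
  trans ((G (r + 1) - G r) * (1 / (X.mid (r + 1) - X.mid r))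
      + (H (r + 2) - H (r + 1)) * (1 / (X.mid (r + 1 + 1) - X.mid (r + 1))))
  · rw [total]
    refine Finset.sum_congr rfl fun i _ => ?_
    simp only [G, H]
    ring
  · simp only [G, H]
    ring

end CrissCross

namespace CrissCross

open Knots

/-! ### Taylor expansions on convex sets of the plane -/

/-- The point `A + t (Z - A)`. -/
def segPoint (A Z : ℝ × ℝ) (t : ℝ) : ℝ × ℝ := (A.1 + t * (Z.1 - A.1), A.2 + t * (Z.2 - A.2))

theorem segPoint_mem {U : Set (ℝ × ℝ)} (hU : Convex ℝ U) {A Z : ℝ × ℝ} (hA : A ∈ U) (hZ : Z ∈ U)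
    {t : ℝ} (ht : t ∈ Set.Icc (0 : ℝ) 1) : segPoint A Z t ∈ U :=
  hU.add_smul_sub_mem hA hZ ht

theorem hasDerivWithinAt_segPoint {U : Set (ℝ × ℝ)} (hU : Convex ℝ U) {g g₁ g₂ : ℝ × ℝ → ℝ}
    (hg : ∀ P ∈ U, HasFDerivWithinAt g (linForm (g₁ P) (g₂ P)) U P) {A Z : ℝ × ℝ} (hA : A ∈ U)
    (hZ : Z ∈ U) {t : ℝ} (ht : t ∈ Set.Icc (0 : ℝ) 1) :
    HasDerivWithinAt (fun s => g (segPoint A Z s))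
      (g₁ (segPoint A Z t) * (Z.1 - A.1) + g₂ (segPoint A Z t) * (Z.2 - A.2))
      (Set.Icc 0 1) t := by
  have h₁ : HasDerivWithinAt (segPoint A Z) (Z.1 - A.1, Z.2 - A.2) (Set.Icc 0 1) t := by
    have a := ((hasDerivWithinAt_id t (Set.Icc 0 1)).mul_const (Z.1 - A.1)).const_add A.1
    have b := ((hasDerivWithinAt_id t (Set.Icc 0 1)).mul_const (Z.2 - A.2)).const_add A.2
    have c := a.prodMk b
    simp only [one_mul] at c
    exact c
  have h := (hg _ (segPoint_mem hU hA hZ ht)).comp_hasDerivWithinAt t h₁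
    fun s hs => segPoint_mem hU hA hZ hs
  rwa [linForm_apply] at h

theorem exists_deriv_eq_sub {φ φ' : ℝ → ℝ}
    (h : ∀ t ∈ Set.Icc (0 : ℝ) 1, HasDerivWithinAt φ (φ' t) (Set.Icc 0 1) t) :
    ∃ t ∈ Set.Ioo (0 : ℝ) 1, φ' t = φ 1 - φ 0 := by
  obtain ⟨t, ht, h'⟩ := exists_hasDerivAt_eq_slope φ φ' zero_lt_one
    (fun s hs => (h s hs).continuousWithinAt)
    fun s hs => (h s (Set.Ioo_subset_Icc_self hs)).hasDerivAt (Icc_mem_nhds hs.1 hs.2)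
  exact ⟨t, ht, by rw [h']; simp⟩

/-- Cauchy's mean value theorem with comparison function `t²`. It supplies the factor `1/2` in the
second-order Taylor remainder. -/
theorem exists_deriv_eq_two_mul_sub {φ φ' : ℝ → ℝ}
    (h : ∀ t ∈ Set.Icc (0 : ℝ) 1, HasDerivWithinAt φ (φ' t) (Set.Icc 0 1) t) :
    ∃ t ∈ Set.Ioo (0 : ℝ) 1, φ' t = 2 * t * (φ 1 - φ 0) := by
  obtain ⟨t, ht, h'⟩ := exists_ratio_hasDerivAt_eq_ratio_slope φ φ' zero_lt_one
    (fun s hs => (h s hs).continuousWithinAt)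
    (fun s hs => (h s (Set.Ioo_subset_Icc_self hs)).hasDerivAt (Icc_mem_nhds hs.1 hs.2))
    (fun s : ℝ => s ^ 2) (fun s => 2 * s) (by fun_prop) fun s _ => by
      simpa using hasDerivAt_pow 2 s
  refine ⟨t, ht, ?_⟩
  linarith

theorem abs_mul_add_mul_le {a b c x y : ℝ} (ha : |a| ≤ c) (hb : |b| ≤ c) :
    |a * x + b * y| ≤ c * (|x| + |y|) := by
  calc |a * x + b * y| ≤ |a| * |x| + |b| * |y| := by
        rw [← abs_mul, ← abs_mul]; exact abs_add_le _ _
    _ ≤ c * |x| + c * |y| := by gcongr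
    _ = c * (|x| + |y|) := by ring

theorem abs_taylor_one_le {U : Set (ℝ × ℝ)} (hU : Convex ℝ U) {g g₁ g₂ : ℝ × ℝ → ℝ}
    (hg : ∀ P ∈ U, HasFDerivWithinAt g (linForm (g₁ P) (g₂ P)) U P) {A Z : ℝ × ℝ} (hA : A ∈ U)
    (hZ : Z ∈ U) {c : ℝ} (h₁ : ∀ t ∈ Set.Icc (0 : ℝ) 1, |g₁ (segPoint A Z t) - g₁ A| ≤ c)
    (h₂ : ∀ t ∈ Set.Icc (0 : ℝ) 1, |g₂ (segPoint A Z t) - g₂ A| ≤ c) :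
    |g Z - g A - (g₁ A * (Z.1 - A.1) + g₂ A * (Z.2 - A.2))| ≤ c * (|Z.1 - A.1| + |Z.2 - A.2|) := by
  obtain ⟨t, ht, h⟩ := exists_deriv_eq_sub fun t ht => hasDerivWithinAt_segPoint hU hg hA hZ ht
  have e₁ : segPoint A Z 1 = Z := by simp [segPoint]
  have e₀ : segPoint A Z 0 = A := by simp [segPoint]
  simp only [e₁, e₀] at h
  have ht' := Set.Ioo_subset_Icc_self ht
  rw [← h, show ∀ a b c d x y : ℝ, a * x + b * y - (c * x + d * y) = (a - c) * x + (b - d) * y from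
    fun a b c d x y => by ring]
  exact abs_mul_add_mul_le (h₁ t ht') (h₂ t ht')

/-- The function `f` is twice differentiable with the given partial derivatives, and the second
derivatives vary by at most `k e` over distances `k η`. -/
structure SecondOrder (U : Set (ℝ × ℝ)) (f fx fy fxx fxy fyy : ℝ × ℝ → ℝ) (η e : ℝ) : Prop where
  deriv : ∀ P ∈ U, HasFDerivWithinAt f (linForm (fx P) (fy P)) U P
  deriv_x : ∀ P ∈ U, HasFDerivWithinAt fx (linForm (fxx P) (fxy P)) U P
  deriv_y : ∀ P ∈ U, HasFDerivWithinAt fy (linForm (fxy P) (fyy P)) U P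
  osc_xx : ∀ k : ℕ, ∀ A ∈ U, ∀ Z ∈ U, |Z.1 - A.1| + |Z.2 - A.2| ≤ k * η → |fxx Z - fxx A| ≤ k * e
  osc_xy : ∀ k : ℕ, ∀ A ∈ U, ∀ Z ∈ U, |Z.1 - A.1| + |Z.2 - A.2| ≤ k * η → |fxy Z - fxy A| ≤ k * e
  osc_yy : ∀ k : ℕ, ∀ A ∈ U, ∀ Z ∈ U, |Z.1 - A.1| + |Z.2 - A.2| ≤ k * η → |fyy Z - fyy A| ≤ k * e

theorem hasFDerivWithinAt_swap {U : Set (ℝ × ℝ)} {g : ℝ × ℝ → ℝ} {a b : ℝ} {P : ℝ × ℝ}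
    (h : HasFDerivWithinAt g (linForm a b) U P.swap) :
    HasFDerivWithinAt (fun P => g P.swap) (linForm b a) (Prod.swap ⁻¹' U) P := by
  have hs : HasFDerivWithinAt (Prod.swap : ℝ × ℝ → ℝ × ℝ)
      ((ContinuousLinearMap.snd ℝ ℝ ℝ).prod (ContinuousLinearMap.fst ℝ ℝ ℝ))
      (Prod.swap ⁻¹' U) P :=
    (hasFDerivAt_snd.prodMk hasFDerivAt_fst).hasFDerivWithinAt
  refine (h.comp P hs fun Q hQ => hQ).congr_fderiv ?_
  ext <;> simp [linForm]

/-- Reduces every statement on `y`-derivatives to one on `x`-derivatives. -/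
theorem SecondOrder.swap {U : Set (ℝ × ℝ)} {f fx fy fxx fxy fyy : ℝ × ℝ → ℝ} {η e : ℝ}
    (h : SecondOrder U f fx fy fxx fxy fyy η e) :
    SecondOrder (Prod.swap ⁻¹' U) (fun P => f P.swap) (fun P => fy P.swap) (fun P => fx P.swap)
      (fun P => fyy P.swap) (fun P => fxy P.swap) (fun P => fxx P.swap) η e where
  deriv P hP := hasFDerivWithinAt_swap (h.deriv _ hP)
  deriv_x P hP := hasFDerivWithinAt_swap (h.deriv_y _ hP)
  deriv_y P hP := hasFDerivWithinAt_swap (h.deriv_x _ hP)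
  osc_xx k A hA Z hZ hAZ := h.osc_yy k _ hA _ hZ (by rwa [add_comm] at hAZ)
  osc_xy k A hA Z hZ hAZ := h.osc_xy k _ hA _ hZ (by rwa [add_comm] at hAZ)
  osc_yy k A hA Z hZ hAZ := h.osc_xx k _ hA _ hZ (by rwa [add_comm] at hAZ)

theorem segPoint_dist_le {A Z : ℝ × ℝ} {t c : ℝ} (ht : t ∈ Set.Icc (0 : ℝ) 1)
    (h : |Z.1 - A.1| + |Z.2 - A.2| ≤ c) :
    |(segPoint A Z t).1 - A.1| + |(segPoint A Z t).2 - A.2| ≤ c := by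
  simp only [segPoint, add_sub_cancel_left, abs_mul, abs_of_nonneg ht.1]
  nlinarith [ht.2, abs_nonneg (Z.1 - A.1), abs_nonneg (Z.2 - A.2)]

theorem SecondOrder.abs_deriv_le {U : Set (ℝ × ℝ)} (hU : Convex ℝ U)
    {f fx fy fxx fxy fyy : ℝ × ℝ → ℝ} {η e : ℝ} (h : SecondOrder U f fx fy fxx fxy fyy η e)
    (k : ℕ) {A Z : ℝ × ℝ} (hA : A ∈ U) (hZ : Z ∈ U) (hAZ : |Z.1 - A.1| + |Z.2 - A.2| ≤ k * η) :
    |fx Z - fx A - (fxx A * (Z.1 - A.1) + fxy A * (Z.2 - A.2))| ≤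
      k * e * (|Z.1 - A.1| + |Z.2 - A.2|) :=
  abs_taylor_one_le hU h.deriv_x hA hZ
    (fun _ ht => h.osc_xx k A hA _ (segPoint_mem hU hA hZ ht) (segPoint_dist_le ht hAZ))
    (fun _ ht => h.osc_xy k A hA _ (segPoint_mem hU hA hZ ht) (segPoint_dist_le ht hAZ))

/-- The quadratic polynomial with value `a`, gradient `(b₁, b₂)` and Hessian `(c₁₁, c₁₂, c₂₂)`
at `A`. -/
noncomputable def quadPoly (A : ℝ × ℝ) (a b₁ b₂ c₁₁ c₁₂ c₂₂ : ℝ) (Z : ℝ × ℝ) : ℝ :=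
  a + b₁ * (Z.1 - A.1) + b₂ * (Z.2 - A.2)
    + (c₁₁ * (Z.1 - A.1) ^ 2 + 2 * c₁₂ * (Z.1 - A.1) * (Z.2 - A.2) + c₂₂ * (Z.2 - A.2) ^ 2) / 2

theorem SecondOrder.nonneg {U : Set (ℝ × ℝ)} {f fx fy fxx fxy fyy : ℝ × ℝ → ℝ} {η e : ℝ}
    (h : SecondOrder U f fx fy fxx fxy fyy η e) (hη : 0 ≤ η) {A : ℝ × ℝ} (hA : A ∈ U) : 0 ≤ e := by
  simpa using h.osc_xx 1 A hA A hA (by simpa using hη)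

/-- The remainder is at most half the squared distance, `(k η)² / 2`, times the variation `k e` of
the second derivatives; hence the factor `k³ / 2`. -/
theorem SecondOrder.abs_sub_quadPoly_le {U : Set (ℝ × ℝ)} (hU : Convex ℝ U)
    {f fx fy fxx fxy fyy : ℝ × ℝ → ℝ} {η e : ℝ} (h : SecondOrder U f fx fy fxx fxy fyy η e)
    (hη : 0 ≤ η) (k : ℕ) {A Z : ℝ × ℝ} (hA : A ∈ U) (hZ : Z ∈ U)
    (hAZ : |Z.1 - A.1| + |Z.2 - A.2| ≤ k * η) :
    |f Z - quadPoly A (f A) (fx A) (fy A) (fxx A) (fxy A) (fyy A) Z| ≤ k ^ 3 / 2 * (η ^ 2 * e) := by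
  have he := h.nonneg hη hA
  set dx := Z.1 - A.1 with hdx
  set dy := Z.2 - A.2 with hdy
  have hφ : ∀ t ∈ Set.Icc (0 : ℝ) 1, HasDerivWithinAt
      (fun t => f (segPoint A Z t) - ((fx A * dx + fy A * dy) * t
        + (fxx A * dx ^ 2 + 2 * fxy A * dx * dy + fyy A * dy ^ 2) / 2 * t ^ 2))
      ((fx (segPoint A Z t) * dx + fy (segPoint A Z t) * dy) - ((fx A * dx + fy A * dy)
        + (fxx A * dx ^ 2 + 2 * fxy A * dx * dy + fyy A * dy ^ 2) / 2 * (2 * t)))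
      (Set.Icc 0 1) t := by
    intro t ht
    refine (hasDerivWithinAt_segPoint hU h.deriv hA hZ ht).sub ?_
    refine HasDerivWithinAt.add ?_ ?_
    · simpa using (hasDerivWithinAt_id t (Set.Icc 0 1)).const_mul (fx A * dx + fy A * dy)
    · refine HasDerivWithinAt.const_mul _ ?_
      simpa using (hasDerivAt_pow 2 t).hasDerivWithinAt
  obtain ⟨t, ht, e₁⟩ := exists_deriv_eq_two_mul_sub hφ
  have ht' := Set.Ioo_subset_Icc_self ht
  have p₁ : segPoint A Z 1 = Z := by simp [segPoint]
  have p₀ : segPoint A Z 0 = A := by simp [segPoint]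
  simp only [p₁, p₀] at e₁
  have hW := segPoint_mem hU hA hZ ht'
  have hd := segPoint_dist_le ht' hAZ
  have b₁ := h.abs_deriv_le hU k hA hW hd
  have b₂ := abs_taylor_one_le hU h.deriv_y hA hW
    (fun s hs => h.osc_xy k A hA _ (segPoint_mem hU hA hW hs) (segPoint_dist_le hs hd))
    (fun s hs => h.osc_yy k A hA _ (segPoint_mem hU hA hW hs) (segPoint_dist_le hs hd))
  have q₁ : (segPoint A Z t).1 - A.1 = t * dx := by simp [segPoint, hdx]
  have q₂ : (segPoint A Z t).2 - A.2 = t * dy := by simp [segPoint, hdy]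
  rw [q₁, q₂] at b₁ b₂
  have hS : |t * dx| + |t * dy| = t * (|dx| + |dy|) := by
    rw [abs_mul, abs_mul, abs_of_pos ht.1]; ring
  rw [hS] at b₁ b₂
  have b := abs_mul_add_mul_le (x := dx) (y := dy) b₁ b₂
  -- The brackets are first-order remainders of the gradient at distance `t (|dx| + |dy|)`, so the
  -- factor `t` cancels against the left side.
  have e₂ : 2 * t * (f Z - quadPoly A (f A) (fx A) (fy A) (fxx A) (fxy A) (fyy A) Z) =
      (fx (segPoint A Z t) - fx A - (fxx A * (t * dx) + fxy A * (t * dy))) * dx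
      + (fy (segPoint A Z t) - fy A - (fxy A * (t * dx) + fyy A * (t * dy))) * dy := by
    rw [quadPoly, ← hdx, ← hdy]
    linear_combination -e₁
  rw [← e₂, abs_mul, abs_of_pos (by linarith [ht.1] : 0 < 2 * t)] at b
  have hs : 0 ≤ |dx| + |dy| := by positivity
  have hsq : (|dx| + |dy|) ^ 2 ≤ (k * η) ^ 2 := by gcongr
  have hke : (0 : ℝ) ≤ k * e := by positivity
  have b' : 2 * t * |f Z - quadPoly A (f A) (fx A) (fy A) (fxx A) (fxy A) (fyy A) Z| ≤
      2 * t * (k ^ 3 / 2 * (η ^ 2 * e)) := by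
    calc _ ≤ t * (k * e * (|dx| + |dy|) ^ 2) := by linarith [b]
      _ ≤ t * (k * e * (k * η) ^ 2) := by
        have := ht.1.le
        gcongr
      _ = _ := by ring
  exact le_of_mul_le_mul_left b' (by linarith [ht.1])

end CrissCross

namespace CrissCross

open Knots

theorem convex_Omega (X Y : Knots) : Convex ℝ (Omega X Y) := (convex_Icc _ _).prod (convex_Icc _ _)

theorem mem_Omega {X Y : Knots} {s t : ℝ} (hs : s ∈ X.segment) (ht : t ∈ Y.segment) :
    (s, t) ∈ Omega X Y := ⟨hs, ht⟩

/-! ### The coefficient functionals -/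

/-- For a quadratic, the mean of the corner values exceeds the central value by an eighth of the
pure second derivatives times the squared steps; the mixed term cancels. -/
theorem muW_quadPoly (X Y : Knots) (i j : ℕ) (A : ℝ × ℝ) (a b₁ b₂ c₁₁ c₁₂ c₂₂ : ℝ) :
    muW X Y (quadPoly A a b₁ b₂ c₁₁ c₁₂ c₂₂) i j =
      quadPoly A a b₁ b₂ c₁₁ c₁₂ c₂₂ (X.mid i, Y.mid j)
        - c₁₁ * X.step i ^ 2 / 8 - c₂₂ * Y.step j ^ 2 / 8 := by
  simp only [muW, quadPoly, mid, step]
  ring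

theorem muS_quadPoly (X Y : Knots) {i j : ℕ} (hi : i ≤ X.m + 1) (hj : j ≤ Y.m + 1) (A : ℝ × ℝ)
    (a b₁ b₂ c₁₁ c₁₂ c₂₂ : ℝ) :
    muS X Y (quadPoly A a b₁ b₂ c₁₁ c₁₂ c₂₂) i j =
      quadPoly A a b₁ b₂ c₁₁ c₁₂ c₂₂ (X.mid i, Y.mid j)
        - c₁₁ * X.step i ^ 2 / 8 - c₂₂ * Y.step j ^ 2 / 8 := by
  obtain ⟨h₁, h₂⟩ := X.coefA_coefC_moments i hi
  obtain ⟨k₁, k₂⟩ := Y.coefA_coefC_moments j hj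
  simp only [muS, quadPoly]
  linear_combination (b₁ + c₁₁ * (X.mid i - A.1) + c₁₂ * (Y.mid j - A.2)) * h₁ + c₁₁ / 2 * h₂
    + (b₂ + c₂₂ * (Y.mid j - A.2) + c₁₂ * (X.mid i - A.1)) * k₁ + c₂₂ / 2 * k₂

theorem muW_eq_add (X Y : Knots) (f g : ℝ × ℝ → ℝ) (i j : ℕ) :
    muW X Y f i j = muW X Y g i j + muW X Y (fun P => f P - g P) i j := by
  simp only [muW]; ring

theorem muS_eq_add (X Y : Knots) (f g : ℝ × ℝ → ℝ) (i j : ℕ) :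
    muS X Y f i j = muS X Y g i j + muS X Y (fun P => f P - g P) i j := by
  simp only [muS]; ring

theorem muW_swap (X Y : Knots) (f : ℝ × ℝ → ℝ) (i j : ℕ) :
    muW Y X (fun P => f P.swap) j i = muW X Y f i j := by
  simp only [muW, Prod.swap_prod_mk]; ring

theorem muS_swap (X Y : Knots) (f : ℝ × ℝ → ℝ) (i j : ℕ) :
    muS Y X (fun P => f P.swap) j i = muS X Y f i j := by
  simp only [muS, Prod.swap_prod_mk]; ring

/-- For a quadratic polynomial, the values of either functional in neighbouring nodes differ by the
derivative at the common knot times the distance of the nodes. -/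
theorem quadPoly_mid_sub (X Y : Knots) (i j : ℕ) (a b₁ b₂ c₁₁ c₁₂ c₂₂ : ℝ) :
    (quadPoly (X.knot i, Y.mid j) a b₁ b₂ c₁₁ c₁₂ c₂₂ (X.mid (i + 1), Y.mid j)
        - c₁₁ * X.step (i + 1) ^ 2 / 8 - c₂₂ * Y.step j ^ 2 / 8)
      - (quadPoly (X.knot i, Y.mid j) a b₁ b₂ c₁₁ c₁₂ c₂₂ (X.mid i, Y.mid j)
        - c₁₁ * X.step i ^ 2 / 8 - c₂₂ * Y.step j ^ 2 / 8)
      = b₁ * (X.mid (i + 1) - X.mid i) := by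
  simp only [quadPoly, mid, step, Nat.add_sub_cancel]
  ring

/-- The two vertical sides of the cell have separate bounds, because the expansion point will lie on
one of them. -/
theorem abs_muW_le (X Y : Knots) {g : ℝ × ℝ → ℝ} {i j : ℕ} {ρ ρ₁ ρ₂ : ℝ}
    (h : |g (X.mid i, Y.mid j)| ≤ ρ) (h₁ : |g (X.knot (i - 1), Y.knot (j - 1))| ≤ ρ₁)
    (h₂ : |g (X.knot (i - 1), Y.knot j)| ≤ ρ₁) (h₃ : |g (X.knot i, Y.knot (j - 1))| ≤ ρ₂)
    (h₄ : |g (X.knot i, Y.knot j)| ≤ ρ₂) : |muW X Y g i j| ≤ 2 * ρ + (ρ₁ + ρ₂) / 2 := by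
  rw [muW]
  rw [abs_le] at *
  constructor <;> linarith [h.1, h.2, h₁.1, h₁.2, h₂.1, h₂.2, h₃.1, h₃.2, h₄.1, h₄.2]

theorem Knots.abs_coefA_mul_add_coefC_mul_le (X : Knots) (i : ℕ) {u v ρ : ℝ} (hu : |u| ≤ ρ)
    (hv : |v| ≤ ρ) : |X.coefA i * u + X.coefC i * v| ≤ ρ := by
  have h₁ := X.coefA_nonpos i
  have h₂ := X.coefC_nonpos i
  have h₃ := X.neg_one_le_coefA_add_coefC i
  have hρ := (abs_nonneg u).trans hu
  calc |X.coefA i * u + X.coefC i * v| ≤ |X.coefA i * u| + |X.coefC i * v| := abs_add_le _ _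
    _ = -X.coefA i * |u| + -X.coefC i * |v| := by
      rw [abs_mul, abs_mul, abs_of_nonpos h₁, abs_of_nonpos h₂]
    _ ≤ -X.coefA i * ρ + -X.coefC i * ρ :=
      add_le_add (mul_le_mul_of_nonneg_left hu (by linarith))
        (mul_le_mul_of_nonneg_left hv (by linarith))
    _ ≤ ρ := by nlinarith

/-- The central weight is at most `3`, and the outer weights in each direction have total modulus at
most `1`. -/
theorem abs_muS_le (X Y : Knots) {g : ℝ × ℝ → ℝ} {i j : ℕ} {ρ ρ' : ℝ}
    (h : |g (X.mid i, Y.mid j)| ≤ ρ) (h₁ : |g (X.mid (i - 1), Y.mid j)| ≤ ρ')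
    (h₂ : |g (X.mid (i + 1), Y.mid j)| ≤ ρ') (h₃ : |g (X.mid i, Y.mid (j - 1))| ≤ ρ')
    (h₄ : |g (X.mid i, Y.mid (j + 1))| ≤ ρ') : |muS X Y g i j| ≤ 3 * ρ + 2 * ρ' := by
  have a₁ := X.abs_coefA_mul_add_coefC_mul_le i h₁ h₂
  have a₂ := Y.abs_coefA_mul_add_coefC_mul_le j h₃ h₄
  have b : |(1 - (X.coefA i + X.coefC i + Y.coefA j + Y.coefC j)) * g (X.mid i, Y.mid j)|
      ≤ 3 * ρ := by
    rw [abs_mul]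
    have c₁ := X.coefA_nonpos i
    have c₂ := X.coefC_nonpos i
    have c₃ := X.neg_one_le_coefA_add_coefC i
    have c₄ := Y.coefA_nonpos j
    have c₅ := Y.coefC_nonpos j
    have c₆ := Y.neg_one_le_coefA_add_coefC j
    refine mul_le_mul ?_ h (abs_nonneg _) (by norm_num)
    rw [abs_le]
    constructor <;> linarith
  rw [muS]
  rw [abs_le] at *
  constructor <;> linarith [a₁.1, a₁.2, a₂.1, a₂.2, b.1, b.2]

section Distances

variable (X : Knots) {η : ℝ}

theorem Knots.abs_mid_sub_knot (h : X.maxStep ≤ 2 * η) (i : ℕ) : |X.mid i - X.knot i| ≤ η := by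
  rw [mid_eq_sub, abs_le]
  constructor <;> linarith [X.step_nonneg i, X.step_le_maxStep i]

theorem Knots.abs_mid_succ_sub_knot (h : X.maxStep ≤ 2 * η) (i : ℕ) :
    |X.mid (i + 1) - X.knot i| ≤ η := by
  rw [mid_succ_eq_add, abs_le]
  constructor <;> linarith [X.step_nonneg (i + 1), X.step_le_maxStep (i + 1)]

theorem Knots.abs_knot_succ_sub (h : X.maxStep ≤ 2 * η) (i : ℕ) :
    |X.knot (i + 1) - X.knot i| ≤ 2 * η := by
  rw [← step_succ, abs_of_nonneg (X.step_nonneg _)]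
  exact (X.step_le_maxStep _).trans h

theorem Knots.abs_knot_sub (h : X.maxStep ≤ 2 * η) (i : ℕ) :
    |X.knot (i - 1) - X.knot i| ≤ 2 * η := by
  rw [abs_sub_comm, ← step, abs_of_nonneg (X.step_nonneg _)]
  exact (X.step_le_maxStep _).trans h

theorem Knots.abs_knot_pred_sub_mid (h : X.maxStep ≤ 2 * η) (i : ℕ) :
    |X.knot (i - 1) - X.mid i| ≤ η := by
  have : X.knot (i - 1) - X.mid i = -(X.step i / 2) := by rw [mid, step]; ring
  rw [this, abs_neg, abs_of_nonneg (by linarith [X.step_nonneg i])]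
  linarith [X.step_le_maxStep i]

theorem Knots.abs_mid_succ_sub_mid (h : X.maxStep ≤ 2 * η) (i : ℕ) :
    |X.mid (i + 1) - X.mid i| ≤ 2 * η := by
  rw [mid_sub_mid, abs_of_nonneg (by linarith [X.step_nonneg i, X.step_nonneg (i + 1)])]
  linarith [X.step_le_maxStep i, X.step_le_maxStep (i + 1)]

theorem Knots.abs_mid_pred_sub_mid (h : X.maxStep ≤ 2 * η) (i : ℕ) :
    |X.mid (i - 1) - X.mid i| ≤ 2 * η := by
  rcases i with _ | i
  · have := (abs_nonneg _).trans (X.abs_mid_sub_knot h 0)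
    simpa using this
  · rw [abs_sub_comm]
    exact X.abs_mid_succ_sub_mid h i

theorem Knots.abs_mid_pred_sub_knot (h : X.maxStep ≤ 2 * η) (i : ℕ) :
    |X.mid (i - 1) - X.knot i| ≤ 3 * η := by
  have h₁ := X.abs_mid_pred_sub_mid h i
  have h₂ := X.abs_mid_sub_knot h i
  have := abs_sub_le (X.mid (i - 1)) (X.mid i) (X.knot i)
  linarith

theorem Knots.abs_mid_succ_succ_sub_knot (h : X.maxStep ≤ 2 * η) (i : ℕ) :
    |X.mid (i + 1 + 1) - X.knot i| ≤ 3 * η := by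
  have h₁ := X.abs_mid_succ_sub_mid h (i + 1)
  have h₂ := X.abs_mid_succ_sub_knot h i
  have := abs_sub_le (X.mid (i + 1 + 1)) (X.mid (i + 1)) (X.knot i)
  linarith

end Distances

/-- The midpoint and the near corners are within `η` of the expansion point, the far corners within
`3 η`, with remainders `1/2` and `27/2` in units of `η² e`. Each functional contributes `2 · 1/2 +
(27/2 + 1/2) / 2 = 8`. -/
theorem SecondOrder.abs_muW_sub_le {X Y : Knots} {f fx fy fxx fxy fyy : ℝ × ℝ → ℝ} {η e : ℝ}
    (h : SecondOrder (Omega X Y) f fx fy fxx fxy fyy η e) (hX : X.maxStep ≤ 2 * η)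
    (hY : Y.maxStep ≤ 2 * η) (i j : ℕ) :
    |muW X Y f (i + 1) j - muW X Y f i j - fx (X.knot i, Y.mid j) * (X.mid (i + 1) - X.mid i)| ≤
      16 * (η ^ 2 * e) := by
  have hη : 0 ≤ η := (abs_nonneg _).trans (X.abs_mid_sub_knot hX 0)
  have hA := mem_Omega (X.knot_mem i) (Y.mid_mem j)
  set A : ℝ × ℝ := (X.knot i, Y.mid j) with hAdef
  have hR : ∀ k : ℕ, ∀ s ∈ X.segment, ∀ t ∈ Y.segment, ∀ a b : ℝ, |s - X.knot i| ≤ a →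
      |t - Y.mid j| ≤ b → a + b ≤ k * η → _ := fun k s hs t ht a b h₁ h₂ h₃ =>
    h.abs_sub_quadPoly_le (convex_Omega X Y) hη k hA (mem_Omega hs ht)
      ((add_le_add h₁ h₂).trans h₃)
  have z₁ : |X.knot i - X.knot i| ≤ 0 := by simp
  have z₂ : |Y.mid j - Y.mid j| ≤ 0 := by simp
  have d₁ := abs_sub_comm (Y.mid j) (Y.knot j) ▸ Y.abs_mid_sub_knot hY j
  have d₂ := Y.abs_knot_pred_sub_mid hY j
  have r₁ := abs_muW_le X Y (i := i) (j := j)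
    (g := fun P => f P - quadPoly A (f A) (fx A) (fy A) (fxx A) (fxy A) (fyy A) P)
    (hR 1 _ (X.mid_mem i) _ (Y.mid_mem j) _ _ (X.abs_mid_sub_knot hX i) z₂ (by push_cast; linarith))
    (hR 3 _ (X.knot_mem _) _ (Y.knot_mem _) _ _ (X.abs_knot_sub hX i) d₂ (by push_cast; linarith))
    (hR 3 _ (X.knot_mem _) _ (Y.knot_mem _) _ _ (X.abs_knot_sub hX i) d₁ (by push_cast; linarith))
    (hR 1 _ (X.knot_mem i) _ (Y.knot_mem _) _ _ z₁ d₂ (by push_cast; linarith))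
    (hR 1 _ (X.knot_mem i) _ (Y.knot_mem _) _ _ z₁ d₁ (by push_cast; linarith))
  have r₂ := abs_muW_le X Y (i := i + 1) (j := j)
    (g := fun P => f P - quadPoly A (f A) (fx A) (fy A) (fxx A) (fxy A) (fyy A) P)
    (hR 1 _ (X.mid_mem (i + 1)) _ (Y.mid_mem j) _ _ (X.abs_mid_succ_sub_knot hX i) z₂
      (by push_cast; linarith))
    (hR 1 _ (X.knot_mem i) _ (Y.knot_mem _) _ _ z₁ d₂ (by push_cast; linarith))
    (hR 1 _ (X.knot_mem i) _ (Y.knot_mem _) _ _ z₁ d₁ (by push_cast; linarith))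
    (hR 3 _ (X.knot_mem _) _ (Y.knot_mem _) _ _ (X.abs_knot_succ_sub hX i) d₂
      (by push_cast; linarith))
    (hR 3 _ (X.knot_mem _) _ (Y.knot_mem _) _ _ (X.abs_knot_succ_sub hX i) d₁
      (by push_cast; linarith))
  have hq := quadPoly_mid_sub X Y i j (f A) (fx A) (fy A) (fxx A) (fxy A) (fyy A)
  rw [← muW_quadPoly, ← muW_quadPoly, ← hAdef] at hq
  have e₁ := muW_eq_add X Y f (quadPoly A (f A) (fx A) (fy A) (fxx A) (fxy A) (fyy A)) i j
  have e₂ := muW_eq_add X Y f (quadPoly A (f A) (fx A) (fy A) (fxx A) (fxy A) (fyy A)) (i + 1) j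
  rw [abs_le] at *
  push_cast at r₁ r₂
  constructor <;> linarith [r₁.1, r₁.2, r₂.1, r₂.2]

/-- The central node is within `η` of the expansion point and the outer nodes within `3 η`, so each
functional contributes `3 · 1/2 + 2 · 27/2 = 57/2`. -/
theorem SecondOrder.abs_muS_sub_le {X Y : Knots} {f fx fy fxx fxy fyy : ℝ × ℝ → ℝ} {η e : ℝ}
    (h : SecondOrder (Omega X Y) f fx fy fxx fxy fyy η e) (hX : X.maxStep ≤ 2 * η)
    (hY : Y.maxStep ≤ 2 * η) {i j : ℕ} (hi : i ≤ X.m) (hj : j ≤ Y.m + 1) :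
    |muS X Y f (i + 1) j - muS X Y f i j - fx (X.knot i, Y.mid j) * (X.mid (i + 1) - X.mid i)| ≤
      57 * (η ^ 2 * e) := by
  have hη : 0 ≤ η := (abs_nonneg _).trans (X.abs_mid_sub_knot hX 0)
  have hA := mem_Omega (X.knot_mem i) (Y.mid_mem j)
  set A : ℝ × ℝ := (X.knot i, Y.mid j) with hAdef
  have hR : ∀ k : ℕ, ∀ i' j' : ℕ, ∀ a b : ℝ, |X.mid i' - X.knot i| ≤ a →
      |Y.mid j' - Y.mid j| ≤ b → a + b ≤ k * η → _ := fun k i' j' a b h₁ h₂ h₃ =>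
    h.abs_sub_quadPoly_le (convex_Omega X Y) hη k hA (mem_Omega (X.mid_mem i') (Y.mid_mem j'))
      ((add_le_add h₁ h₂).trans h₃)
  have z : |Y.mid j - Y.mid j| ≤ 0 := by simp
  have d₁ := X.abs_mid_sub_knot hX i
  have d₂ := X.abs_mid_succ_sub_knot hX i
  have d₃ := Y.abs_mid_pred_sub_mid hY j
  have d₄ := Y.abs_mid_succ_sub_mid hY j
  have r₁ := abs_muS_le X Y (i := i) (j := j)
    (g := fun P => f P - quadPoly A (f A) (fx A) (fy A) (fxx A) (fxy A) (fyy A) P)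
    (hR 1 i j _ _ d₁ z (by push_cast; linarith))
    (hR 3 (i - 1) j _ _ (X.abs_mid_pred_sub_knot hX i) z (by push_cast; linarith))
    (hR 3 (i + 1) j _ _ d₂ z (by push_cast; linarith))
    (hR 3 i (j - 1) _ _ d₁ d₃ (by push_cast; linarith))
    (hR 3 i (j + 1) _ _ d₁ d₄ (by push_cast; linarith))
  have r₂ := abs_muS_le X Y (i := i + 1) (j := j)
    (g := fun P => f P - quadPoly A (f A) (fx A) (fy A) (fxx A) (fxy A) (fyy A) P)
    (hR 1 (i + 1) j _ _ d₂ z (by push_cast; linarith))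
    (hR 3 (i + 1 - 1) j _ _ d₁ z (by push_cast; linarith))
    (hR 3 (i + 1 + 1) j _ _ (X.abs_mid_succ_succ_sub_knot hX i) z (by push_cast; linarith))
    (hR 3 (i + 1) (j - 1) _ _ d₂ d₃ (by push_cast; linarith))
    (hR 3 (i + 1) (j + 1) _ _ d₂ d₄ (by push_cast; linarith))
  have hq := quadPoly_mid_sub X Y i j (f A) (fx A) (fy A) (fxx A) (fxy A) (fyy A)
  rw [← muS_quadPoly X Y (by omega) hj, ← muS_quadPoly X Y (by omega) hj, ← hAdef] at hq
  have e₁ := muS_eq_add X Y f (quadPoly A (f A) (fx A) (fy A) (fxx A) (fxy A) (fyy A)) i j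
  have e₂ := muS_eq_add X Y f (quadPoly A (f A) (fx A) (fy A) (fxx A) (fxy A) (fyy A)) (i + 1) j
  rw [abs_le] at *
  push_cast at r₁ r₂
  constructor <;> linarith [r₁.1, r₁.2, r₂.1, r₂.2]

end CrissCross

/-! ### From coefficient differences to the derivative of the spline. -/

namespace CrissCross

open Knots

theorem abs_convex_comb_sub_le {w w' D D' l l' E : ℝ} (hw : 0 ≤ w) (hw' : 0 ≤ w') (h : w + w' = 1)
    (hD : |D - l| ≤ E) (hD' : |D' - l'| ≤ E) : |w * D + w' * D' - (w * l + w' * l')| ≤ E := by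
  calc |w * D + w' * D' - (w * l + w' * l')| = |w * (D - l) + w' * (D' - l')| := by ring_nf
    _ ≤ w * |D - l| + w' * |D' - l'| := by
      rw [← abs_of_nonneg hw, ← abs_of_nonneg hw', ← abs_mul, ← abs_mul, abs_of_nonneg hw,
        abs_of_nonneg hw']
      exact abs_add_le _ _
    _ ≤ w * E + w' * E := by gcongr
    _ = E := by rw [← add_mul, h, one_mul]

/-- If the difference quotients of the coefficients of a spline approximate an affine function in
the points `(x i, t j)`, then so does the derivative of the spline. -/
theorem abs_splineDeriv_sub_le (X Y : Knots) (c : ℕ → ℕ → ℝ) {r q : ℕ} (hr : r < X.m) (hq : q < Y.m)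
    {P : ℝ × ℝ} (hP : P ∈ X.piece r ×ˢ Y.piece q) {a b₁ b₂ E : ℝ}
    (h : ∀ i ∈ Set.Icc r (r + 1), ∀ j ∈ Set.Icc q (q + 2),
      |(c (i + 1) j - c i j) / (X.mid (i + 1) - X.mid i)
        - (a + b₁ * (X.knot i - P.1) + b₂ * (Y.mid j - P.2))| ≤ E) :
    |splineDeriv X Y c P - a| ≤ E := by
  have hu := X.coord_mem hr hP.1
  have hv := Y.coord_mem hq hP.2
  have eu := X.coord_mul_step hr P.1
  have ev := Y.coord_mul_step hq P.2
  rw [splineDeriv_eq X Y c hr hq hP]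
  rw [step_succ] at eu ev
  -- This inequality on the unit square makes the weight of the center nonnegative.
  have hsd : |X.coord (r + 1) P.1 + Y.coord (q + 1) P.2 - 1|
      + |X.coord (r + 1) P.1 - Y.coord (q + 1) P.2| ≤ 1 := by
    rcases abs_cases (X.coord (r + 1) P.1 + Y.coord (q + 1) P.2 - 1) with ⟨e, _⟩ | ⟨e, _⟩ <;>
    rcases abs_cases (X.coord (r + 1) P.1 - Y.coord (q + 1) P.2) with ⟨e', _⟩ | ⟨e', _⟩ <;>
    rw [e, e'] <;> linarith [hu.1, hu.2, hv.1, hv.2]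
  dsimp only
  generalize X.coord (r + 1) P.1 = u at *
  generalize Y.coord (q + 1) P.2 = v at *
  have hs₁ := le_abs_self (u + v - 1)
  have hs₂ := neg_abs_le (u + v - 1)
  have hd₁ := le_abs_self (u - v)
  have hd₂ := neg_abs_le (u - v)
  generalize |u + v - 1| = s at *
  generalize |u - v| = d at *
  -- By `sigma_mul_mid` the combination of the data at `t k` and `t (k + 1)` belongs to the height
  -- `y k`, so it represents a corner of the cell.
  have corner : ∀ i ∈ Set.Icc r (r + 1), ∀ k ∈ Set.Icc q (q + 1),
      |Y.sigma (k + 1) * ((c (i + 1) k - c i k) / (X.mid (i + 1) - X.mid i))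
        + Y.sigma' (k + 1) * ((c (i + 1) (k + 1) - c i (k + 1)) / (X.mid (i + 1) - X.mid i))
        - (a + b₁ * (X.knot i - P.1) + b₂ * (Y.knot k - P.2))| ≤ E := by
    intro i hi k hk
    obtain ⟨k₁, k₂⟩ := hk
    have h₁ := Y.sigma_add_sigma' (i := k) (by omega)
    have h₂ := Y.sigma_mul_mid (i := k) (by omega)
    have := abs_convex_comb_sub_le (Y.sigma_nonneg (k + 1)) (Y.sigma'_nonneg (k + 1)) h₁
      (h i hi k ⟨k₁, by omega⟩) (h i hi (k + 1) ⟨by omega, by omega⟩)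
    convert this using 3
    linear_combination -(a + b₁ * (X.knot i - P.1) - b₂ * P.2) * h₁ - b₂ * h₂
  have mr : r ∈ Set.Icc r (r + 1) := ⟨le_rfl, by omega⟩
  have mr' : r + 1 ∈ Set.Icc r (r + 1) := ⟨by omega, le_rfl⟩
  have mq : q ∈ Set.Icc q (q + 1) := ⟨le_rfl, by omega⟩
  have mq' : q + 1 ∈ Set.Icc q (q + 1) := ⟨by omega, le_rfl⟩
  have c₁ := corner r mr q mq
  have c₂ := corner r mr (q + 1) mq'
  have c₃ := h r mr (q + 1) ⟨by omega, by omega⟩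
  have c₄ := corner (r + 1) mr' q mq
  have c₅ := corner (r + 1) mr' (q + 1) mq'
  have c₆ := h (r + 1) mr' (q + 1) ⟨by omega, by omega⟩
  rw [Y.mid_succ] at c₃ c₆
  have w₁ : 0 ≤ (s - (u + v - 1)) / 2 := by linarith
  have w₂ : 0 ≤ (d - (u - v)) / 2 := by linarith
  have w₃ : 0 ≤ (1 - s - d) / 2 := by linarith
  have w₄ : 0 ≤ (d + (u - v)) / 2 := by linarith
  have w₅ : 0 ≤ (s + (u + v - 1)) / 2 := by linarith
  have key : ∀ {w D l : ℝ}, 0 ≤ w → |D - l| ≤ E → |w * D - w * l| ≤ w * E := by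
    intro w D l hw hD
    rw [← mul_sub, abs_mul, abs_of_nonneg hw]
    exact mul_le_mul_of_nonneg_left hD hw
  have t₁ := abs_le.mp (key w₁ c₁)
  have t₂ := abs_le.mp (key w₂ c₂)
  have t₃ := abs_le.mp (key w₃ c₃)
  have t₄ := abs_le.mp (key w₄ c₄)
  have t₅ := abs_le.mp (key w₅ c₅)
  have t₆ := abs_le.mp (key w₃ c₆)
  -- The weights interpolate linearly between the corners and the center, hence reproduce the affine
  -- function at `P`, where its value is `a`.
  have total : (s - (u + v - 1)) / 2 * (a + b₁ * (X.knot r - P.1) + b₂ * (Y.knot q - P.2))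
      + (d - (u - v)) / 2 * (a + b₁ * (X.knot r - P.1) + b₂ * (Y.knot (q + 1) - P.2))
      + (1 - s - d) / 2 * (a + b₁ * (X.knot r - P.1)
        + b₂ * ((Y.knot q + Y.knot (q + 1)) / 2 - P.2))
      + (d + (u - v)) / 2 * (a + b₁ * (X.knot (r + 1) - P.1) + b₂ * (Y.knot q - P.2))
      + (s + (u + v - 1)) / 2 * (a + b₁ * (X.knot (r + 1) - P.1) + b₂ * (Y.knot (q + 1) - P.2))
      + (1 - s - d) / 2 * (a + b₁ * (X.knot (r + 1) - P.1)
        + b₂ * ((Y.knot q + Y.knot (q + 1)) / 2 - P.2)) = a := by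
    linear_combination b₁ * eu + b₂ * ev
  have totalE : (s - (u + v - 1)) / 2 * E + (d - (u - v)) / 2 * E + (1 - s - d) / 2 * E
      + (d + (u - v)) / 2 * E + (s + (u + v - 1)) / 2 * E + (1 - s - d) / 2 * E = E := by ring
  rw [abs_le]
  constructor
  · linarith [t₁.1, t₂.1, t₃.1, t₄.1, t₅.1, t₆.1]
  · linarith [t₁.2, t₂.2, t₃.2, t₄.2, t₅.2, t₆.2]

/-- The first term is the coefficient error divided by a midpoint distance. In the second, `25 = 5 ·
5`: the points `(x i, t j)` lie within `5 η` of `P`, and the Taylor remainder of `fx` is at most `5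
e` times that distance. -/
theorem SecondOrder.abs_splineDeriv_sub_le {X Y : Knots} {f fx fy fxx fxy fyy : ℝ × ℝ → ℝ}
    {η e δ K : ℝ} (h : SecondOrder (Omega X Y) f fx fy fxx fxy fyy η e) (hX : X.maxStep ≤ 2 * η)
    (hY : Y.maxStep ≤ 2 * η) (hδ : 0 < δ) (hδX : δ ≤ X.minStep) {c : ℕ → ℕ → ℝ}
    (hc : ∀ i ≤ X.m, ∀ j ≤ Y.m + 1,
      |c (i + 1) j - c i j - fx (X.knot i, Y.mid j) * (X.mid (i + 1) - X.mid i)| ≤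
        K * (η ^ 2 * e)) {P : ℝ × ℝ} (hP : P ∈ Omega X Y) :
    |fx P - splineDeriv X Y c P| ≤ (2 * K * (η / δ) + 25) * (η * e) := by
  obtain ⟨r, hr, hPr⟩ := X.exists_cell hP.1
  obtain ⟨q, hq, hPq⟩ := Y.exists_cell hP.2
  have hη : 0 ≤ η := (abs_nonneg _).trans (X.abs_mid_sub_knot hX 0)
  have he := h.nonneg hη hP
  rw [abs_sub_comm]
  refine CrissCross.abs_splineDeriv_sub_le X Y c hr hq ⟨hPr, hPq⟩ (b₁ := fxx P) (b₂ := fxy P) ?_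
  intro i hi j hj
  obtain ⟨i₁, i₂⟩ := hi
  obtain ⟨j₁, j₂⟩ := hj
  -- At the ends one of the two adjacent steps is zero, so only a single step is guaranteed.
  have hgap : δ / 2 ≤ X.mid (i + 1) - X.mid i := by
    rw [mid_sub_mid]
    linarith [X.minStep_le_step_add_step (i := i) (by omega)]
  have hgap₀ : 0 < X.mid (i + 1) - X.mid i := by linarith
  have b₁ : |(c (i + 1) j - c i j) / (X.mid (i + 1) - X.mid i) - fx (X.knot i, Y.mid j)| ≤
      2 * K * (η / δ) * (η * e) := by
    have hc' := hc i (by omega) j (by omega)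
    have hK := (abs_nonneg _).trans hc'
    rw [show (c (i + 1) j - c i j) / (X.mid (i + 1) - X.mid i) - fx (X.knot i, Y.mid j) =
      (c (i + 1) j - c i j - fx (X.knot i, Y.mid j) * (X.mid (i + 1) - X.mid i))
        / (X.mid (i + 1) - X.mid i) by field_simp, abs_div, abs_of_pos hgap₀]
    calc _ ≤ K * (η ^ 2 * e) / (δ / 2) := by gcongr
      _ = _ := by field_simp
  have kr := X.abs_knot_succ_sub hX r
  rw [abs_of_nonneg (sub_nonneg.mpr (X.knot_mono (Nat.le_succ r)))] at kr
  have kq := Y.abs_knot_succ_sub hY q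
  rw [abs_of_nonneg (sub_nonneg.mpr (Y.knot_mono (Nat.le_succ q)))] at kq
  have d₁ : |X.knot i - P.1| ≤ 2 * η := by
    rw [abs_le]
    obtain rfl | rfl : i = r ∨ i = r + 1 := by omega
    · constructor <;> linarith [hPr.1, hPr.2]
    · constructor <;> linarith [hPr.1, hPr.2]
  -- The outer midpoints lie up to half a step outside the cell, which adds `η` to its height `2 η`.
  have d₂ : |Y.mid j - P.2| ≤ 3 * η := by
    obtain rfl | rfl | rfl : j = q ∨ j = q + 1 ∨ j = q + 1 + 1 := by omega
    · have := Y.abs_mid_sub_knot hY j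
      rw [abs_le] at this ⊢
      constructor <;> linarith [hPq.1, hPq.2]
    · rw [mid_succ, abs_le]
      constructor <;> linarith [hPq.1, hPq.2]
    · have := Y.abs_mid_succ_sub_knot hY (q + 1)
      rw [abs_le] at this ⊢
      constructor <;> linarith [hPq.1, hPq.2]
  have d : |X.knot i - P.1| + |Y.mid j - P.2| ≤ 5 * η := by linarith
  have b₂ := h.abs_deriv_le (convex_Omega X Y) 5 hP (mem_Omega (X.knot_mem i) (Y.mid_mem j))
    (by push_cast; exact d)
  have b₃ : (5 : ℕ) * e * (|X.knot i - P.1| + |Y.mid j - P.2|) ≤ 25 * (η * e) := by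
    push_cast
    nlinarith
  have b₄ := b₂.trans b₃
  dsimp only at b₄
  rw [abs_le] at *
  constructor <;> linarith [b₁.1, b₁.2, b₄.1, b₄.2]

/-! ### The error of a spline -/

theorem Knots.left_lt_right (X : Knots) : X.x 0 < X.x X.m := by
  have h₁ := X.knot_lt_succ (i := 0) X.one_le
  have h₂ := X.knot_mono (show 0 + 1 ≤ X.m from X.one_le)
  rw [← X.knot_of_le (Nat.zero_le _), ← X.knot_of_le le_rfl]
  linarith

theorem uniqueDiffOn_Omega (X Y : Knots) : UniqueDiffOn ℝ (Omega X Y) :=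
  (uniqueDiffOn_Icc X.left_lt_right).prod (uniqueDiffOn_Icc Y.left_lt_right)

theorem isCompact_Omega (X Y : Knots) : IsCompact (Omega X Y) := isCompact_Icc.prod isCompact_Icc

theorem partialD_one_zero {X Y : Knots} {g : ℝ × ℝ → ℝ} {a b : ℝ} {P : ℝ × ℝ} (hP : P ∈ Omega X Y)
    (h : HasFDerivWithinAt g (linForm a b) (Omega X Y) P) : partialD (Omega X Y) (1, 0) g P = a := by
  change fderivWithin ℝ g (Omega X Y) P (1, 0) = a
  rw [h.fderivWithin (uniqueDiffOn_Omega X Y P hP), linForm_apply]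
  simp

theorem partialD_zero_one {X Y : Knots} {g : ℝ × ℝ → ℝ} {a b : ℝ} {P : ℝ × ℝ} (hP : P ∈ Omega X Y)
    (h : HasFDerivWithinAt g (linForm a b) (Omega X Y) P) : partialD (Omega X Y) (0, 1) g P = b := by
  change fderivWithin ℝ g (Omega X Y) P (0, 1) = b
  rw [h.fderivWithin (uniqueDiffOn_Omega X Y P hP), linForm_apply]
  simp

theorem swap_preimage_Omega (X Y : Knots) : Prod.swap ⁻¹' Omega X Y = Omega Y X :=
  Set.preimage_swap_prod _ _

theorem contDiffOn_spline (X Y : Knots) (c : ℕ → ℕ → ℝ) :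
    ContDiffOn ℝ 1 (spline X Y c) (Omega X Y) := by
  have hd := hasFDerivWithinAt_spline X Y c
  rw [show (1 : WithTop ℕ∞) = 0 + 1 by simp,
    contDiffOn_succ_iff_fderivWithin (uniqueDiffOn_Omega X Y)]
  refine ⟨fun P _ => (hd P).differentiableWithinAt, by simp, contDiffOn_zero.mpr ?_⟩
  have hc : ContinuousOn (fun P => linForm (splineDeriv X Y c P)
      (splineDeriv Y X (fun j i => c i j) P.swap)) (Omega X Y) := by
    have hs : ContinuousOn (fun P : ℝ × ℝ => splineDeriv Y X (fun j i => c i j) P.swap)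
        (Omega X Y) :=
      (continuousOn_splineDeriv Y X fun j i => c i j).comp continuous_swap.continuousOn
        fun P hP => ⟨hP.2, hP.1⟩
    exact ((continuousOn_splineDeriv X Y c).smul continuousOn_const).add
      (hs.smul continuousOn_const)
  exact hc.congr fun P hP => (hd P).fderivWithin (uniqueDiffOn_Omega X Y P hP)

theorem SecondOrder.firstDerivError {X Y : Knots} {f fx fy fxx fxy fyy : ℝ × ℝ → ℝ} {η e K ε : ℝ}
    (h : SecondOrder (Omega X Y) f fx fy fxx fxy fyy η e) (hη : meshMax X Y = 2 * η)
    {c : ℕ → ℕ → ℝ}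
    (hc : ∀ i ≤ X.m, ∀ j ≤ Y.m + 1,
      |c (i + 1) j - c i j - fx (X.knot i, Y.mid j) * (X.mid (i + 1) - X.mid i)| ≤
        K * (η ^ 2 * e))
    (hc' : ∀ j ≤ Y.m, ∀ i ≤ X.m + 1,
      |c i (j + 1) - c i j - fy (X.mid i, Y.knot j) * (Y.mid (j + 1) - Y.mid j)| ≤
        K * (η ^ 2 * e))
    (hε : (2 * K * (η / meshMin X Y) + 25) * (η * e) ≤ ε) :
    FirstDerivError (Omega X Y) f (spline X Y c) ε := by
  have hX : X.maxStep ≤ 2 * η := hη ▸ le_max_left _ _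
  have hY : Y.maxStep ≤ 2 * η := hη ▸ le_max_right _ _
  have hδ : 0 < meshMin X Y := lt_min X.minStep_pos Y.minStep_pos
  refine ⟨contDiffOn_spline X Y c, fun α hα P hP => ?_⟩
  have hα' : α = (1, 0) ∨ α = (0, 1) := by
    obtain ⟨α₁, α₂⟩ := α
    simp only [Prod.mk.injEq] at hα ⊢
    omega
  have hs := hasFDerivWithinAt_spline X Y c P
  rcases hα' with rfl | rfl
  · rw [partialD_one_zero hP (h.deriv P hP), partialD_one_zero hP hs]
    exact (h.abs_splineDeriv_sub_le hX hY hδ (min_le_left _ _) hc hP).trans hε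
  · rw [partialD_zero_one hP (h.deriv P hP), partialD_zero_one hP hs]
    have h' := h.swap
    rw [swap_preimage_Omega] at h'
    exact (h'.abs_splineDeriv_sub_le hY hX hδ (min_le_right _ _) (c := fun j i => c i j) hc'
      (P := P.swap) ⟨hP.2, hP.1⟩).trans hε

theorem SecondOrder.firstDerivError_W2star {X Y : Knots} {f fx fy fxx fxy fyy : ℝ × ℝ → ℝ}
    {η e ε : ℝ} (h : SecondOrder (Omega X Y) f fx fy fxx fxy fyy η e) (hη : meshMax X Y = 2 * η)
    (hε : (2 * 16 * (η / meshMin X Y) + 25) * (η * e) ≤ ε) :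
    FirstDerivError (Omega X Y) f (W2star X Y f) ε := by
  have hX : X.maxStep ≤ 2 * η := hη ▸ le_max_left _ _
  have hY : Y.maxStep ≤ 2 * η := hη ▸ le_max_right _ _
  have h' := h.swap
  rw [swap_preimage_Omega] at h'
  refine h.firstDerivError hη (c := muW X Y f) (fun i _ j _ => h.abs_muW_sub_le hX hY i j)
    (fun j _ i _ => ?_) hε
  have := h'.abs_muW_sub_le hY hX j i
  rwa [muW_swap, muW_swap] at this

theorem SecondOrder.firstDerivError_S2 {X Y : Knots} {f fx fy fxx fxy fyy : ℝ × ℝ → ℝ}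
    {η e ε : ℝ} (h : SecondOrder (Omega X Y) f fx fy fxx fxy fyy η e) (hη : meshMax X Y = 2 * η)
    (hε : (2 * 57 * (η / meshMin X Y) + 25) * (η * e) ≤ ε) :
    FirstDerivError (Omega X Y) f (S2 X Y f) ε := by
  have hX : X.maxStep ≤ 2 * η := hη ▸ le_max_left _ _
  have hY : Y.maxStep ≤ 2 * η := hη ▸ le_max_right _ _
  have h' := h.swap
  rw [swap_preimage_Omega] at h'
  refine h.firstDerivError hη (c := muS X Y f) (fun i hi j hj => h.abs_muS_sub_le hX hY hi hj)
    (fun j hj i hi => ?_) hε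
  have := h'.abs_muS_sub_le hY hX hj hi
  rwa [muS_swap, muS_swap] at this

end CrissCross

/-! ### Regularity of `f` and the resulting control of its second derivatives. -/

namespace CrissCross

open Knots

/-! ### Partial derivatives -/

theorem hasFDerivWithinAt_partialD {X Y : Knots} {g : ℝ × ℝ → ℝ} {P : ℝ × ℝ}
    (hg : DifferentiableWithinAt ℝ g (Omega X Y) P) :
    HasFDerivWithinAt g
      (linForm (partialD (Omega X Y) (1, 0) g P) (partialD (Omega X Y) (0, 1) g P))
      (Omega X Y) P := by
  refine hg.hasFDerivWithinAt.congr_fderiv ?_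
  ext
  · simp [linForm, partialD]
  · simp [linForm, partialD]

theorem contDiffOn_fderivWithin_apply {X Y : Knots} {g : ℝ × ℝ → ℝ} {n : ℕ}
    (hg : ContDiffOn ℝ (n + 1) g (Omega X Y)) (v : ℝ × ℝ) :
    ContDiffOn ℝ n (fun P => fderivWithin ℝ g (Omega X Y) P v) (Omega X Y) :=
  (hg.fderivWithin (uniqueDiffOn_Omega X Y) le_rfl).clm_apply contDiffOn_const

theorem contDiffOn_partialD {X Y : Knots} (α : ℕ × ℕ) {n : ℕ} {g : ℝ × ℝ → ℝ}
    (hg : ContDiffOn ℝ (n + (α.1 + α.2) : ℕ) g (Omega X Y)) :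
    ContDiffOn ℝ n (partialD (Omega X Y) α g) (Omega X Y) := by
  have iter : ∀ (v : ℝ × ℝ) (k n : ℕ) (g : ℝ × ℝ → ℝ),
      ContDiffOn ℝ (n + k : ℕ) g (Omega X Y) →
      ContDiffOn ℝ n ((fun g P => fderivWithin ℝ g (Omega X Y) P v)^[k] g) (Omega X Y) := by
    intro v k
    induction k with
    | zero => intro n g hg; simpa using hg
    | succ k ih =>
      intro n g hg
      rw [Function.iterate_succ_apply]
      refine ih n _ (contDiffOn_fderivWithin_apply ?_ v)
      exact_mod_cast hg
  refine iter _ _ _ _ (iter _ _ _ _ ?_)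
  rwa [add_assoc]

theorem Omega_subset_closure_interior (X Y : Knots) :
    Omega X Y ⊆ closure (interior (Omega X Y)) := by
  rw [(convex_Omega X Y).closure_interior_eq_closure_of_nonempty_interior ?_]
  · exact subset_closure
  · rw [Omega, Knots.segment, Knots.segment, interior_prod_eq, interior_Icc, interior_Icc]
    exact (Set.nonempty_Ioo.mpr X.left_lt_right).prod (Set.nonempty_Ioo.mpr Y.left_lt_right)

/-- Symmetry of second derivatives extends to boundary points because the rectangle lies in the
closure of its interior. -/
theorem partialD_comm {X Y : Knots} {g : ℝ × ℝ → ℝ} (hg : ContDiffOn ℝ 2 g (Omega X Y))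
    {P : ℝ × ℝ} (hP : P ∈ Omega X Y) :
    partialD (Omega X Y) (0, 1) (partialD (Omega X Y) (1, 0) g) P =
      partialD (Omega X Y) (1, 0) (partialD (Omega X Y) (0, 1) g) P := by
  have hu := uniqueDiffOn_Omega X Y
  have hd : DifferentiableWithinAt ℝ (fderivWithin ℝ g (Omega X Y)) (Omega X Y) P :=
    (hg.fderivWithin (m := 1) hu (by norm_num)).differentiableOn (by norm_num) P hP
  have e : ∀ v w : ℝ × ℝ, fderivWithin ℝ (fun Q => fderivWithin ℝ g (Omega X Y) Q v) (Omega X Y) P w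
      = fderivWithin ℝ (fderivWithin ℝ g (Omega X Y)) (Omega X Y) P w v := by
    intro v w
    rw [fderivWithin_clm_apply (hu P hP) hd (differentiableWithinAt_const v)]
    simp
  have hs := (hg P hP).isSymmSndFDerivWithinAt (by simp) hu
    (Omega_subset_closure_interior X Y hP) hP
  change fderivWithin ℝ (fun Q => fderivWithin ℝ g (Omega X Y) Q (1, 0)) (Omega X Y) P (0, 1) =
    fderivWithin ℝ (fun Q => fderivWithin ℝ g (Omega X Y) Q (0, 1)) (Omega X Y) P (1, 0)
  rw [e, e]
  exact hs _ _

theorem partialD_congr {X Y : Knots} {g₁ g₂ : ℝ × ℝ → ℝ} (h : Set.EqOn g₁ g₂ (Omega X Y))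
    {P : ℝ × ℝ} (hP : P ∈ Omega X Y) :
    partialD (Omega X Y) (1, 0) g₁ P = partialD (Omega X Y) (1, 0) g₂ P := by
  change fderivWithin ℝ g₁ (Omega X Y) P (1, 0) = fderivWithin ℝ g₂ (Omega X Y) P (1, 0)
  rw [fderivWithin_congr h (h hP)]

/-- A function of class `C²` satisfies `SecondOrder` with its partial derivatives, as soon as the
second ones have the required modulus of continuity. -/
theorem secondOrder_of_contDiffOn {X Y : Knots} {f : ℝ × ℝ → ℝ} (hf : ContDiffOn ℝ 2 f (Omega X Y))
    {η e : ℝ} (h : ∀ α ∈ Finset.HasAntidiagonal.antidiagonal 2, ∀ k : ℕ, ∀ A ∈ Omega X Y,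
      ∀ Z ∈ Omega X Y, |Z.1 - A.1| + |Z.2 - A.2| ≤ k * η →
        |partialD (Omega X Y) α f Z - partialD (Omega X Y) α f A| ≤ k * e) :
    SecondOrder (Omega X Y) f (partialD (Omega X Y) (1, 0) f) (partialD (Omega X Y) (0, 1) f)
      (partialD (Omega X Y) (2, 0) f) (partialD (Omega X Y) (1, 1) f)
      (partialD (Omega X Y) (0, 2) f) η e := by
  have hx : ContDiffOn ℝ (1 : ℕ) (partialD (Omega X Y) (1, 0) f) (Omega X Y) :=
    contDiffOn_partialD (1, 0) (by exact_mod_cast hf)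
  have hy : ContDiffOn ℝ (1 : ℕ) (partialD (Omega X Y) (0, 1) f) (Omega X Y) :=
    contDiffOn_partialD (0, 1) (by exact_mod_cast hf)
  refine ⟨fun P hP => hasFDerivWithinAt_partialD (hf.differentiableOn (by norm_num) P hP),
    fun P hP => ?_, fun P hP => ?_, h _ (by simp), h _ (by simp), h _ (by simp)⟩
  · have := hasFDerivWithinAt_partialD (hx.differentiableOn (by norm_num) P hP)
    rw [partialD_comm hf hP] at this
    exact this
  · exact hasFDerivWithinAt_partialD (hy.differentiableOn (by norm_num) P hP)

/-! ### Moduli of continuity and norms -/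

/-- The Euclidean distance is at most the sum of the coordinate distances. Compactness bounds the
set, without which `sSup` would carry no information. -/
theorem abs_sub_le_modulus {U : Set (ℝ × ℝ)} (hU : IsCompact U) {ψ : ℝ × ℝ → ℝ}
    (hψ : ContinuousOn ψ U) {t : ℝ} {A Z : ℝ × ℝ} (hA : A ∈ U) (hZ : Z ∈ U)
    (h : |Z.1 - A.1| + |Z.2 - A.2| ≤ t) : |ψ Z - ψ A| ≤ modulus U ψ t := by
  obtain ⟨C, hC⟩ := hU.exists_bound_of_continuousOn hψ
  refine le_csSup ⟨C + C, ?_⟩ ⟨Z, hZ, A, hA, ?_, rfl⟩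
  · rintro _ ⟨M, hM, P, hP, -, rfl⟩
    exact (abs_sub _ _).trans (add_le_add (hC M hM) (hC P hP))
  · refine le_trans (Real.sqrt_le_iff.mpr ⟨by positivity, ?_⟩) h
    nlinarith [sq_abs (Z.1 - A.1), sq_abs (Z.2 - A.2), abs_nonneg (Z.1 - A.1),
      abs_nonneg (Z.2 - A.2)]

/-- Subadditivity of the modulus on a convex set: the point at ratio `k / (k + 1)` of the segment
splits off one piece of length at most `t`. -/
theorem abs_sub_le_mul_modulus {U : Set (ℝ × ℝ)} (hU : IsCompact U) (hUc : Convex ℝ U)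
    {ψ : ℝ × ℝ → ℝ} (hψ : ContinuousOn ψ U) {t : ℝ} (k : ℕ) {A Z : ℝ × ℝ} (hA : A ∈ U)
    (hZ : Z ∈ U) (h : |Z.1 - A.1| + |Z.2 - A.2| ≤ k * t) : |ψ Z - ψ A| ≤ k * modulus U ψ t := by
  induction k generalizing Z with
  | zero =>
    rw [Nat.cast_zero, zero_mul] at h
    have h₁ : Z.1 - A.1 = 0 :=
      abs_nonpos_iff.mp (by linarith [abs_nonneg (Z.2 - A.2)])
    have h₂ : Z.2 - A.2 = 0 :=
      abs_nonpos_iff.mp (by linarith [abs_nonneg (Z.1 - A.1)])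
    have : Z = A := Prod.ext (by linarith) (by linarith)
    simp [this]
  | succ k ih =>
    have hk : (0 : ℝ) < k + 1 := by positivity
    push_cast at h ⊢
    set s : ℝ := k / (k + 1) with hs
    have hs' : s ∈ Set.Icc (0 : ℝ) 1 :=
      ⟨by positivity, by rw [hs, div_le_one hk]; linarith⟩
    have hW := segPoint_mem hUc hA hZ hs'
    have hsk : s * (k + 1) = k := by rw [hs]; field_simp
    have d₁ : |(segPoint A Z s).1 - A.1| + |(segPoint A Z s).2 - A.2| ≤ k * t := by
      simp only [segPoint, add_sub_cancel_left, abs_mul, abs_of_nonneg hs'.1]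
      calc _ = s * (|Z.1 - A.1| + |Z.2 - A.2|) := by ring
        _ ≤ s * ((k + 1) * t) := mul_le_mul_of_nonneg_left h hs'.1
        _ = k * t := by rw [← mul_assoc, hsk]
    have d₂ : |Z.1 - (segPoint A Z s).1| + |Z.2 - (segPoint A Z s).2| ≤ t := by
      have e₁ : Z.1 - (segPoint A Z s).1 = (1 - s) * (Z.1 - A.1) := by simp only [segPoint]; ring
      have e₂ : Z.2 - (segPoint A Z s).2 = (1 - s) * (Z.2 - A.2) := by simp only [segPoint]; ring
      have hs₁ : 0 ≤ 1 - s := by linarith [hs'.2]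
      rw [e₁, e₂, abs_mul, abs_mul, abs_of_nonneg hs₁]
      calc _ = (1 - s) * (|Z.1 - A.1| + |Z.2 - A.2|) := by ring
        _ ≤ (1 - s) * ((k + 1) * t) := mul_le_mul_of_nonneg_left h hs₁
        _ = t := by linear_combination -t * hsk
    have := abs_sub_le (ψ Z) (ψ (segPoint A Z s)) (ψ A)
    linarith [ih hW d₁, abs_sub_le_modulus hU hψ hW hZ d₂]

theorem modulus_nonneg (U : Set (ℝ × ℝ)) (ψ : ℝ × ℝ → ℝ) (t : ℝ) : 0 ≤ modulus U ψ t := by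
  refine Real.sSup_nonneg ?_
  rintro _ ⟨M, -, P, -, -, rfl⟩
  exact abs_nonneg _

theorem modulus_le_modulusD (U : Set (ℝ × ℝ)) {s : ℕ} (f : ℝ × ℝ → ℝ) (t : ℝ) {α : ℕ × ℕ}
    (hα : α ∈ Finset.HasAntidiagonal.antidiagonal s) :
    modulus U (partialD U α f) t ≤ modulusD U s f t :=
  Finset.le_sup' (fun α => modulus U (partialD U α f) t) hα

theorem supNorm_le_normD (U : Set (ℝ × ℝ)) {s : ℕ} (f : ℝ × ℝ → ℝ) {α : ℕ × ℕ}
    (hα : α ∈ Finset.HasAntidiagonal.antidiagonal s) : supNorm U (partialD U α f) ≤ normD U s f :=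
  Finset.le_sup' (fun α => supNorm U (partialD U α f)) hα

theorem abs_le_supNorm {U : Set (ℝ × ℝ)} (hU : IsCompact U) {ψ : ℝ × ℝ → ℝ}
    (hψ : ContinuousOn ψ U) {P : ℝ × ℝ} (hP : P ∈ U) : |ψ P| ≤ supNorm U ψ :=
  le_csSup (hU.bddAbove_image hψ.abs) ⟨P, hP, rfl⟩

theorem abs_partialD_le_normD {X Y : Knots} {s : ℕ} {f : ℝ × ℝ → ℝ}
    (hf : ContDiffOn ℝ s f (Omega X Y)) {α : ℕ × ℕ}
    (hα : α ∈ Finset.HasAntidiagonal.antidiagonal s) {P : ℝ × ℝ} (hP : P ∈ Omega X Y) :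
    |partialD (Omega X Y) α f P| ≤ normD (Omega X Y) s f := by
  have hc : ContDiffOn ℝ (0 : ℕ) (partialD (Omega X Y) α f) (Omega X Y) :=
    contDiffOn_partialD α (by rwa [Finset.HasAntidiagonal.mem_antidiagonal.mp hα, zero_add])
  exact (abs_le_supNorm (isCompact_Omega X Y) hc.continuousOn hP).trans (supNorm_le_normD _ f hα)

theorem secondOrder_modulusD {X Y : Knots} {f : ℝ × ℝ → ℝ} (hf : ContDiffOn ℝ 2 f (Omega X Y))
    (η : ℝ) :
    SecondOrder (Omega X Y) f (partialD (Omega X Y) (1, 0) f) (partialD (Omega X Y) (0, 1) f)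
      (partialD (Omega X Y) (2, 0) f) (partialD (Omega X Y) (1, 1) f)
      (partialD (Omega X Y) (0, 2) f) η (modulusD (Omega X Y) 2 f η) := by
  refine secondOrder_of_contDiffOn hf fun α hα k A hA Z hZ h => ?_
  have hc : ContDiffOn ℝ (0 : ℕ) (partialD (Omega X Y) α f) (Omega X Y) :=
    contDiffOn_partialD α (by rw [Finset.HasAntidiagonal.mem_antidiagonal.mp hα]; exact_mod_cast hf)
  refine (abs_sub_le_mul_modulus (isCompact_Omega X Y) (convex_Omega X Y) hc.continuousOn k hA hZ
    h).trans ?_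
  exact mul_le_mul_of_nonneg_left (modulus_le_modulusD _ f η hα) (Nat.cast_nonneg k)

theorem abs_sub_le_of_partialD {X Y : Knots} {g : ℝ × ℝ → ℝ}
    (hg : DifferentiableOn ℝ g (Omega X Y)) {M : ℝ}
    (h₁ : ∀ P ∈ Omega X Y, |partialD (Omega X Y) (1, 0) g P| ≤ M)
    (h₂ : ∀ P ∈ Omega X Y, |partialD (Omega X Y) (0, 1) g P| ≤ M) {A Z : ℝ × ℝ}
    (hA : A ∈ Omega X Y) (hZ : Z ∈ Omega X Y) :
    |g Z - g A| ≤ M * (|Z.1 - A.1| + |Z.2 - A.2|) := by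
  obtain ⟨t, ht, h⟩ := exists_deriv_eq_sub fun t ht =>
    hasDerivWithinAt_segPoint (convex_Omega X Y)
      (fun P hP => hasFDerivWithinAt_partialD (hg P hP)) hA hZ ht
  have hW := segPoint_mem (convex_Omega X Y) hA hZ (Set.Ioo_subset_Icc_self ht)
  have e₁ : segPoint A Z 1 = Z := by simp [segPoint]
  have e₀ : segPoint A Z 0 = A := by simp [segPoint]
  simp only [e₁, e₀] at h
  rw [← h]
  exact abs_mul_add_mul_le (h₁ _ hW) (h₂ _ hW)

theorem normD_nonneg {X Y : Knots} {f : ℝ × ℝ → ℝ} {s : ℕ} (hf : ContDiffOn ℝ s f (Omega X Y)) :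
    0 ≤ normD (Omega X Y) s f :=
  (abs_nonneg _).trans (abs_partialD_le_normD hf (α := (0, s)) (by simp)
    (mem_Omega (X.knot_mem 0) (Y.knot_mem 0)))

/-- Second derivatives are Lipschitz with constant `‖D³f‖` for the sum of the coordinate distances,
so they vary by at most `k η ‖D³f‖` over `k η`. -/
theorem secondOrder_normD {X Y : Knots} {f : ℝ × ℝ → ℝ} (hf : ContDiffOn ℝ 3 f (Omega X Y))
    (η : ℝ) :
    SecondOrder (Omega X Y) f (partialD (Omega X Y) (1, 0) f) (partialD (Omega X Y) (0, 1) f)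
      (partialD (Omega X Y) (2, 0) f) (partialD (Omega X Y) (1, 1) f)
      (partialD (Omega X Y) (0, 2) f) η (η * normD (Omega X Y) 3 f) := by
  have hf₃ : ContDiffOn ℝ (3 : ℕ) f (Omega X Y) := by exact_mod_cast hf
  have hf₂ : ContDiffOn ℝ 2 f (Omega X Y) := hf.of_le (by norm_num)
  have hx : ContDiffOn ℝ (2 : ℕ) (partialD (Omega X Y) (1, 0) f) (Omega X Y) :=
    contDiffOn_partialD (1, 0) (by exact_mod_cast hf)
  have hy : ContDiffOn ℝ (2 : ℕ) (partialD (Omega X Y) (0, 1) f) (Omega X Y) :=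
    contDiffOn_partialD (0, 1) (by exact_mod_cast hf)
  have hb : ∀ α ∈ Finset.HasAntidiagonal.antidiagonal 3, ∀ P ∈ Omega X Y,
      |partialD (Omega X Y) α f P| ≤ normD (Omega X Y) 3 f := fun α hα P hP =>
    abs_partialD_le_normD hf₃ hα hP
  -- `partialD` takes the `y`-derivatives first, so this `y`-derivative has to be moved past two
  -- `x`-derivatives.
  have hxxy : ∀ P ∈ Omega X Y, partialD (Omega X Y) (0, 1) (partialD (Omega X Y) (2, 0) f) P =
      partialD (Omega X Y) (2, 1) f P := fun P hP =>
    (partialD_comm (g := partialD (Omega X Y) (1, 0) f) (by exact_mod_cast hx) hP).trans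
      (partialD_congr (fun Q hQ => partialD_comm hf₂ hQ) hP)
  have hxyy : ∀ P ∈ Omega X Y, partialD (Omega X Y) (0, 1) (partialD (Omega X Y) (1, 1) f) P =
      partialD (Omega X Y) (1, 2) f P := fun P hP =>
    partialD_comm (g := partialD (Omega X Y) (0, 1) f) (by exact_mod_cast hy) hP
  refine secondOrder_of_contDiffOn hf₂ fun α hα k A hA Z hZ h => ?_
  have hα₂ := Finset.HasAntidiagonal.mem_antidiagonal.mp hα
  have hc : ContDiffOn ℝ (1 : ℕ) (partialD (Omega X Y) α f) (Omega X Y) :=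
    contDiffOn_partialD α (by rw [hα₂]; exact_mod_cast hf)
  have hM := normD_nonneg hf₃
  have key : |partialD (Omega X Y) α f Z - partialD (Omega X Y) α f A| ≤
      normD (Omega X Y) 3 f * (|Z.1 - A.1| + |Z.2 - A.2|) := by
    have hα' : α = (2, 0) ∨ α = (1, 1) ∨ α = (0, 2) := by
      obtain ⟨α₁, α₂⟩ := α
      simp only [Prod.mk.injEq] at hα₂ ⊢
      omega
    refine abs_sub_le_of_partialD (hc.differentiableOn (by norm_num)) (fun P hP => ?_)
      (fun P hP => ?_) hA hZ
    · rcases hα' with rfl | rfl | rfl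
      · exact hb (3, 0) (by simp) P hP
      · exact hb (2, 1) (by simp) P hP
      · exact hb (1, 2) (by simp) P hP
    · rcases hα' with rfl | rfl | rfl
      · rw [hxxy P hP]
        exact hb (2, 1) (by simp) P hP
      · rw [hxyy P hP]
        exact hb (1, 2) (by simp) P hP
      · exact hb (0, 3) (by simp) P hP
  calc _ ≤ normD (Omega X Y) 3 f * (k * η) := key.trans (mul_le_mul_of_nonneg_left h hM)
    _ = k * (η * normD (Omega X Y) 3 f) := by ring

/-! ### Comparison of constants. -/

theorem one_le_meshMax_div_meshMin (X Y : Knots) : 1 ≤ meshMax X Y / meshMin X Y := by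
  refine (one_le_div (lt_min X.minStep_pos Y.minStep_pos)).mpr ?_
  exact (min_le_left _ _).trans (X.minStep_le_maxStep.trans (le_max_left _ _))

theorem meshMax_nonneg (X Y : Knots) : 0 ≤ meshMax X Y :=
  ((X.minStep_pos.le).trans X.minStep_le_maxStep).trans (le_max_left _ _)

theorem modulusD_nonneg (U : Set (ℝ × ℝ)) (s : ℕ) (f : ℝ × ℝ → ℝ) (t : ℝ) :
    0 ≤ modulusD U s f t :=
  (modulus_nonneg U _ t).trans (modulus_le_modulusD U f t (α := (0, s)) (by simp))

/-- The error bound of `SecondOrder.firstDerivError` in terms of `h = 2 η`. -/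
theorem half_mesh_bound_le {K C h ρ δ e : ℝ} (hδ : ρ = h / δ) (hρ : 1 ≤ ρ) (hh : 0 ≤ h) (he : 0 ≤ e)
    (hC : K / 2 + 25 / 2 ≤ C) :
    (2 * K * (h / 2 / δ) + 25) * (h / 2 * e) ≤ C * ρ * h * e := by
  have e₁ : h / 2 / δ = ρ / 2 := by rw [hδ]; ring
  have hhe := mul_nonneg hh he
  rw [e₁]
  have : (K * ρ + 25) / 2 ≤ C * ρ := by nlinarith
  nlinarith

theorem firstDerivBound_modulusD (X Y : Knots) (f : ℝ × ℝ → ℝ) {K C : ℝ}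
    (hC : K / 2 + 25 / 2 ≤ C) :
    (2 * K * (meshMax X Y / 2 / meshMin X Y) + 25)
        * (meshMax X Y / 2 * modulusD (Omega X Y) 2 f (meshMax X Y / 2)) ≤
      (1 + C * (meshMax X Y / meshMin X Y)) * meshMax X Y
        * modulusD (Omega X Y) 2 f (meshMax X Y / 2) := by
  have hh := meshMax_nonneg X Y
  have he := modulusD_nonneg (Omega X Y) 2 f (meshMax X Y / 2)
  refine (half_mesh_bound_le rfl (one_le_meshMax_div_meshMin X Y) hh he hC).trans ?_
  -- The summand `1` in the bracket is not needed: since `h / δ ≥ 1`, the term `C h / δ` already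
  -- absorbs everything.
  gcongr
  linarith

theorem firstDerivBound_normD {X Y : Knots} {f : ℝ × ℝ → ℝ} (hf : ContDiffOn ℝ 3 f (Omega X Y))
    {K C : ℝ} (hC : K / 2 + 25 / 2 ≤ 2 * C) :
    (2 * K * (meshMax X Y / 2 / meshMin X Y) + 25)
        * (meshMax X Y / 2 * (meshMax X Y / 2 * normD (Omega X Y) 3 f)) ≤
      C * (meshMax X Y / meshMin X Y) * meshMax X Y ^ 2 * normD (Omega X Y) 3 f := by
  have hh := meshMax_nonneg X Y
  have hM : 0 ≤ normD (Omega X Y) 3 f := normD_nonneg (by exact_mod_cast hf)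
  refine (half_mesh_bound_le rfl (one_le_meshMax_div_meshMin X Y) hh
    (by positivity) hC).trans (le_of_eq ?_)
  ring

end CrissCross

theorem theorem5 :
    -- (i) functions of class `C²`, first for `S₂`, then for `W₂*`
    (∃ C₂ : ℝ, 0 < C₂ ∧ C₂ ≤ 122 ∧
      ∀ (X Y : Knots) (f : ℝ × ℝ → ℝ), ContDiffOn ℝ 2 f (Omega X Y) →
        FirstDerivError (Omega X Y) f (S2 X Y f)
          ((1 + C₂ * (meshMax X Y / meshMin X Y)) * meshMax X Y
            * modulusD (Omega X Y) 2 f (meshMax X Y / 2))) ∧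
    (∃ C₂ : ℝ, 0 < C₂ ∧ C₂ ≤ 65 ∧
      ∀ (X Y : Knots) (f : ℝ × ℝ → ℝ), ContDiffOn ℝ 2 f (Omega X Y) →
        FirstDerivError (Omega X Y) f (W2star X Y f)
          ((1 + C₂ * (meshMax X Y / meshMin X Y)) * meshMax X Y
            * modulusD (Omega X Y) 2 f (meshMax X Y / 2))) ∧
    -- (ii) functions of class `C³`, first for `S₂`, then for `W₂*`
    (∃ C₃ : ℝ, 0 < C₃ ∧ C₃ ≤ 269 / 12 ∧
      ∀ (X Y : Knots) (f : ℝ × ℝ → ℝ), ContDiffOn ℝ 3 f (Omega X Y) →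
        FirstDerivError (Omega X Y) f (S2 X Y f)
          (C₃ * (meshMax X Y / meshMin X Y) * meshMax X Y ^ 2 * normD (Omega X Y) 3 f)) ∧
    (∃ C₃ : ℝ, 0 < C₃ ∧ C₃ ≤ 65 / 6 ∧
      ∀ (X Y : Knots) (f : ℝ × ℝ → ℝ), ContDiffOn ℝ 3 f (Omega X Y) →
        FirstDerivError (Omega X Y) f (W2star X Y f)
          (C₃ * (meshMax X Y / meshMin X Y) * meshMax X Y ^ 2 * normD (Omega X Y) 3 f)) := by
  have hη : ∀ X Y : Knots, meshMax X Y = 2 * (meshMax X Y / 2) := fun X Y => by ring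
  -- The prescribed bounds serve as constants. The estimate itself needs only `K / 2 + 25 / 2`, that
  -- is `41` and `41 / 2`, in (i), and half of these in (ii), where `e` carries a further factor `h
  -- / 2`.
  refine ⟨⟨122, by norm_num, le_rfl, fun X Y f hf => ?_⟩, ⟨65, by norm_num, le_rfl,
    fun X Y f hf => ?_⟩, ⟨269 / 12, by norm_num, le_rfl, fun X Y f hf => ?_⟩,
    ⟨65 / 6, by norm_num, le_rfl, fun X Y f hf => ?_⟩⟩
  · exact (secondOrder_modulusD hf _).firstDerivError_S2 (hη X Y)
      (firstDerivBound_modulusD X Y f (by norm_num))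
  · exact (secondOrder_modulusD hf _).firstDerivError_W2star (hη X Y)
      (firstDerivBound_modulusD X Y f (by norm_num))
  · exact (secondOrder_normD hf _).firstDerivError_S2 (hη X Y)
      (firstDerivBound_normD hf (by norm_num))
  · exact (secondOrder_normD hf _).firstDerivError_W2star (hη X Y)
      (firstDerivBound_normD hf (by norm_num))
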